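/- Let $M$ be a connected, complete, finite-dimensional smooth Riemannian manifold with Riemannian distance $\mathrm d$, let $n\ge 1$, $I=\{1,\dots,n\}$, and let $F=(f_1,\dots,f_n):M\to\mathbb R^n$ be continuously differentiable. For $x,y\in\mathbb R^n$ write $x\preceq y$ if $x_i\le y_i$ for all $i\in I$. For $p\in M$ and $v\in T_pM$ put $$JF(p)(v)=(\langle\nabla f_i(p),v\rangle)_{i\in I},\qquad \alpha_p(v)=\max_{i\in I}\langle\nabla f_i(p),v\rangle+\tfrac12\|v\|^2,\qquad \alpha_p^*=\min_{v\in T_pM}\alpha_p(v).$$ The point $p$ is *Pareto critical* if there is no $v\in T_pM$ with $\langle\nabla f_i(p),v\rangle<0$ for all $i\in I$. For $\sigma\in(0,1)$ let $D_\sigma(p)=\{v\in T_pM:\alpha_p(v)\le(1-\sigma)\alpha_p^*\}$. **Algorithm.** Choose $p_0\in M$, $\sigma,\beta\in(0,1)$, $R\in[1,\infty)$; set $k=0$. If $p_k$ is Pareto critical, stop. Otherwise choose $v_k\in D_\sigma(p_k)$, let $\gamma_k$ be the geodesic with $\gamma_k(0)=p_k$, $\gamma_k'(0)=v_k$, choose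 a step size $t_k\in(0,R]$ with $$F(\gamma_k(t_k))\preceq F(p_k)+\beta t_k\,JF(p_k)(v_k),\qquad(*)$$ set $p_{k+1}=\gamma_k(t_k)$, and repeat with $k+1$ in place of $k$. The step sizes are *Armijo* if, for some fixed $\nu\in(0,1)$ and all $k$, $$t_k=\max\{\nu^{i}: i=0,1,2,\dots,\ F(\gamma_k(\nu^{i}))\preceq F(p_k)+\beta\nu^{i}JF(p_k)(v_k)\}.$$ **Proposition.** The algorithm is well defined: at every point $p$ that is not Pareto critical, $D_\sigma(p)\neq\emptyset$, and for each $v\in D_\sigma(p)$ there is a geodesic $\gamma:\mathbb R\to M$ with $\gamma(0)=p$, $\gamma'(0)=v$, and for every such geodesic there is $t\in(0,1]$ with $F(\gamma(t))\preceq F(p)+\beta t\,JF(p)(v)$. Moreover, every (finite or infinite) sequence $\{p_k\}$ generated by the algorithm has the following properties. (i) For every step $k$ that is carried out, $F(p_{k+1})\preceq F(p_k)$, and $\mathrm d(\gamma_k(t),p_k)\le t\|v_k\|$ for all $t\in[0,t_k]$. (ii) If $\varphi(p):=\sup_{q\in M}\min_{i\in I}(f_i(p)-f_i(q))$ is finite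 for every $p\in M$, then $\sum_k t_k^2\|v_k\|^2<\infty$, the sum being over all steps carried out. (iii) Suppose that the sequence is infinite and that $\{t_k\}$ has a positive lower bound or the step sizes are Armijo. Then every cluster point of $\{p_k\}$ is a Pareto critical point of $F$. -/

import Mathlib

open Set Filter Topology Bundle
open scoped Manifold ContDiff

noncomputable section

namespace ParetoDescent

/-- The `m`-dimensional Euclidean space on which the manifolds are modelled. -/
abbrev Model (m : ℕ) : Type := EuclideanSpace ℝ (Fin m)

section Geodesics

variable {m : ℕ} {M : Type*} [MetricSpace M] [ChartedSpace (Model m) M]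
  [RiemannianBundle (fun x : M => TangentSpace (𝓡 m) x)]

/-- The Riemannian metric in the coordinates of the chart at `c`: for a coordinate vector `x` and
`a b : ℝᵐ`, the number `g_x(a, b) = ∑ g_{ij}(x) aⁱ bʲ`, i.e. the inner product of the tangent
vectors of `M` whose coordinates are `a` and `b`. -/
def chartMetric (c : M) (x a b : Model m) : ℝ :=
  inner ℝ
    (mfderiv 𝓘(ℝ, Model m) (𝓡 m) (extChartAt (𝓡 m) c).symm x a :
      TangentSpace (𝓡 m) ((extChartAt (𝓡 m) c).symm x))
    (mfderiv 𝓘(ℝ, Model m) (𝓡 m) (extChartAt (𝓡 m) c).symm x b :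
      TangentSpace (𝓡 m) ((extChartAt (𝓡 m) c).symm x))

/-- The Christoffel symbols of the first kind of the Levi-Civita connection in the chart at `c`
(Koszul's formula for constant coordinate fields `a`, `b`, `w`):
`⟨∇_a b, w⟩ = (∂_a g(b, w) + ∂_b g(a, w) - ∂_w g(a, b)) / 2` at `x`. -/
def christoffel (c : M) (x a b w : Model m) : ℝ :=
  (fderiv ℝ (fun y => chartMetric c y b w) x a
    + fderiv ℝ (fun y => chartMetric c y a w) x b
    - fderiv ℝ (fun y => chartMetric c y a b) x w) / 2

/-- The inner product `⟨∇_{γ'} γ', w⟩` at time `t` in the chart at `c`: with `x(s)` the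
coordinates of `γ s`, it is `g_x(x'', w) + Γ_x(x', x'; w)`. -/
def chartAcceleration (c : M) (γ : ℝ → M) (t : ℝ) (w : Model m) : ℝ :=
  let x : ℝ → Model m := fun s => extChartAt (𝓡 m) c (γ s)
  chartMetric c (x t) (deriv (deriv x) t) w + christoffel c (x t) (deriv x t) (deriv x t) w

/-- A geodesic `γ : ℝ → M`, i.e. `∇_{γ'} γ' = 0` for the Levi-Civita connection: the geodesic
equation holds in all charts of the atlas. (Curves are taken to be `C²`, which is what the
equation needs; solutions are then automatically smooth.) -/
def IsGeodesic (m : ℕ) {M : Type*} [MetricSpace M] [ChartedSpace (Model m) M]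
    [RiemannianBundle (fun x : M => TangentSpace (𝓡 m) x)] (γ : ℝ → M) : Prop :=
  ContMDiff 𝓘(ℝ, ℝ) (𝓡 m) 2 γ ∧
    ∀ (c : M) (t : ℝ), γ t ∈ (extChartAt (𝓡 m) c).source →
      ∀ w : Model m, chartAcceleration c γ t w = 0

end Geodesics

/-- The velocity of a curve, as a point `(γ t, γ' t)` of the tangent bundle. -/
def velocity (m : ℕ) {M : Type*} [TopologicalSpace M] [ChartedSpace (Model m) M] (γ : ℝ → M) (t : ℝ) : TangentBundle (𝓡 m) M :=
  ⟨γ t, mfderiv 𝓘(ℝ, ℝ) (𝓡 m) γ t (1 : ℝ)⟩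

section Descent

variable {m n : ℕ} {M : Type*} [MetricSpace M] [ChartedSpace (Model m) M]

/-- The Jacobian `JF(p)(v) = (⟨∇f_i(p), v⟩)_i = (df_i(p) v)_i` of `F = (f_1, …, f_n)`. -/
def jacobian (F : M → Fin n → ℝ) (p : M) (v : TangentSpace (𝓡 m) p) : Fin n → ℝ :=
  fun i => (mfderiv (𝓡 m) 𝓘(ℝ, ℝ) (fun q => F q i) p v : ℝ)

/-- `p` is Pareto critical: the image of `JF(p)` contains no vector with all components
negative. -/
def IsParetoCritical (m : ℕ) {n : ℕ} {M : Type*} [MetricSpace M] [ChartedSpace (Model m) M]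
    (F : M → Fin n → ℝ) (p : M) : Prop :=
  ¬ ∃ v : TangentSpace (𝓡 m) p, ∀ i, jacobian F p v i < 0

/-- `φ(p) = sup_q min_i (f_i(p) - f_i(q))` is a real number for every `p`. -/
def MeritIsReal {n : ℕ} {M : Type*} (F : M → Fin n → ℝ) : Prop :=
  ∀ p : M, BddAbove (range fun q : M => ⨅ i, (F p i - F q i))

variable [RiemannianBundle (fun x : M => TangentSpace (𝓡 m) x)]

/-- `α_p(v) = max_i ⟨∇f_i(p), v⟩ + ‖v‖² / 2`. -/
def alpha (F : M → Fin n → ℝ) (p : M) (v : TangentSpace (𝓡 m) p) : ℝ :=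
  (⨆ i, jacobian F p v i) + ‖v‖ ^ 2 / 2

/-- `D_σ(p)`, the `σ`-approximate steepest descent directions: `α_p(v) ≤ (1 - σ) α_p^*`, where
`α_p^* = α_p(u)` is the value of `α_p` at its minimizer `u`. -/
def approxSteepest (m : ℕ) {n : ℕ} {M : Type*} [MetricSpace M] [ChartedSpace (Model m) M]
    [RiemannianBundle (fun x : M => TangentSpace (𝓡 m) x)] (F : M → Fin n → ℝ) (σ : ℝ) (p : M) : Set (TangentSpace (𝓡 m) p) :=
  {v | ∃ u : TangentSpace (𝓡 m) p, IsMinOn (alpha (m := m) F p) univ u ∧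
    alpha F p v ≤ (1 - σ) * alpha F p u}

/-- The step-size inequality `F(γ(t)) ⪯ F(p) + β t JF(p)(v)` (componentwise order). -/
def SufficientDecrease (F : M → Fin n → ℝ) (β : ℝ) (p : M) (v : TangentSpace (𝓡 m) p)
    (γ : ℝ → M) (t : ℝ) : Prop :=
  F (γ t) ≤ F p + (β * t) • jacobian F p v

/-- The data `p_k, v_k, t_k, γ_k` are generated by the inexact descent algorithm with parameters
`σ, β, R`. `N ≤ ∞` is the number of steps performed: steps `k < N` are carried out, and if `N` is
finite the algorithm stops at `p_N`, which is then Pareto critical. Only the terms `p_k` with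
`k ≤ N`, and `v_k, t_k, γ_k` with `k < N`, are meaningful. -/
structure IsGenerated (F : M → Fin n → ℝ) (σ β R : ℝ) (N : ℕ∞) (p : ℕ → M)
    (v : ∀ k, TangentSpace (𝓡 m) (p k)) (t : ℕ → ℝ) (γ : ℕ → ℝ → M) : Prop where
  not_critical : ∀ k : ℕ, (k : ℕ∞) < N → ¬ IsParetoCritical m F (p k)
  direction : ∀ k : ℕ, (k : ℕ∞) < N → v k ∈ approxSteepest m F σ (p k)
  geodesic : ∀ k : ℕ, (k : ℕ∞) < N → IsGeodesic m (γ k)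
  initial : ∀ k : ℕ, (k : ℕ∞) < N → velocity m (γ k) 0 = ⟨p k, v k⟩
  step_mem : ∀ k : ℕ, (k : ℕ∞) < N → t k ∈ Ioc 0 R
  decrease : ∀ k : ℕ, (k : ℕ∞) < N → SufficientDecrease F β (p k) (v k) (γ k) (t k)
  next : ∀ k : ℕ, (k : ℕ∞) < N → p (k + 1) = γ k (t k)
  terminal : ∀ k : ℕ, (k : ℕ∞) = N → IsParetoCritical m F (p k)

/-- The Armijo step sizes with ratio `ν`, for an infinite run:
`t_k = max {νⁱ : i ∈ ℕ, F(γ_k(νⁱ)) ⪯ F(p_k) + β νⁱ JF(p_k)(v_k)}`. -/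
def IsArmijo (F : M → Fin n → ℝ) (β ν : ℝ) (p : ℕ → M)
    (v : ∀ k, TangentSpace (𝓡 m) (p k)) (t : ℕ → ℝ) (γ : ℕ → ℝ → M) : Prop :=
  ∀ k, IsGreatest {s : ℝ | ∃ i : ℕ, s = ν ^ i ∧ SufficientDecrease F β (p k) (v k) (γ k) s} (t k)

end Descent

end ParetoDescent

end

/-! The descent estimates rest on comparing `alpha` at `v ∈ D_σ(p)` with its value at an arbitrary
vector `w` (`jacobian_le_of_mem_approxSteepest`). The choice `w = 0` gives `⟨∇f_i(p), v⟩ ≤ -‖v‖²/2`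
for all `i`. At a noncritical point, a small multiple of a common descent direction makes `alpha`
negative, because its linear part beats its quadratic part; hence all `⟨∇f_i(p), v⟩` are negative. A
first-order expansion along the geodesic then produces a step size. For (ii), the bound `-‖v‖²/2`
and `t_k ≤ R` dominate `t_k² ‖v_k‖²` by a multiple of `f_i(p_k) - f_i(p_{k+1})`, which telescopes.

For (iii), suppose that a cluster point `q` is noncritical. Near `q` the optimal value of `alpha`
stays below some `-a < 0` (`exists_alpha_le_near`), so the decrease of `f_0` is at least a constant
times `t_k` along an ultrafilter converging to `q`. The values `f_0(p_k)` are monotone and converge,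
so `t_k → 0` along it, which rules out a positive lower bound. For Armijo steps the `v_k` are
bounded near `q`, hence converge in a chart. Geodesics with nearby initial velocities keep nearby
velocities for a common time, so the longer step `t_k/ν` eventually satisfies the step-size
inequality too, against the maximality of `t_k`.

The geometry behind this is built from the geodesic equation in charts, `x'' = -spray x x'`, whose
right-hand side is `C¹`. This gives uniqueness (`eqOn_of_isGeodesicAt`) and local existence, uniform
in the initial velocity (`exists_isGeodesicAt_uniform`). Constant speed yields the distance bound in
(i) and, with metric completeness, geodesics on all of `ℝ` (`exists_isGeodesic`). -/

namespace ParetoDescent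

set_option maxSynthPendingDepth 3

/-! ### The metric, Christoffel symbols and geodesic spray in one chart. -/

section ChartMetric

variable {m : ℕ} {M : Type*} [MetricSpace M] [ChartedSpace (Model m) M]
  [RiemannianBundle (fun x : M => TangentSpace (𝓡 m) x)]

/-- The chart metric as a continuous bilinear form. -/
noncomputable def chartForm (c : M) (x : Model m) : Model m →L[ℝ] Model m →L[ℝ] ℝ :=
  LinearMap.toContinuousLinearMap
    ((LinearMap.toContinuousLinearMap (𝕜 := ℝ) (E := Model m) (F' := ℝ)).toLinearMap ∘ₗ
      LinearMap.mk₂ ℝ (chartMetric c x)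
        (fun a b _ => (congrArg (fun u => inner ℝ u _)
          (ContinuousLinearMap.map_add _ a b)).trans (inner_add_left _ _ _))
        (fun r a _ => (congrArg (fun u => inner ℝ u _)
          (ContinuousLinearMap.map_smul _ r a)).trans (real_inner_smul_left _ _ _))
        (fun _ b w => (congrArg (fun u => inner ℝ _ u)
          (ContinuousLinearMap.map_add _ b w)).trans (inner_add_right _ _ _))
        (fun r _ w => (congrArg (fun u => inner ℝ _ u)
          (ContinuousLinearMap.map_smul _ r w)).trans (real_inner_smul_right _ _ _)))

@[simp] lemma chartForm_apply (c : M) (x a b : Model m) :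
    chartForm c x a b = chartMetric c x a b := rfl

lemma chartMetric_comm (c : M) (x a b : Model m) : chartMetric c x a b = chartMetric c x b a :=
  real_inner_comm _ _

variable [IsManifold (𝓡 m) ∞ M]

lemma chartMetric_pos {c : M} {x : Model m} (hx : x ∈ (extChartAt (𝓡 m) c).target)
    {a : Model m} (ha : a ≠ 0) : 0 < chartMetric c x a a := by
  apply real_inner_self_pos.2
  intro h
  have hinj : Function.Injective
      (mfderiv 𝓘(ℝ, Model m) (𝓡 m) (extChartAt (𝓡 m) c).symm x) := by
    have := isInvertible_mfderivWithin_extChartAt_symm (I := 𝓡 m) (x := c) hx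
    simp only [modelWithCornersSelf_coe, range_id, mfderivWithin_univ] at this
    exact this.injective
  exact ha (hinj (h.trans (map_zero _).symm))

/-- Positive definiteness gives injectivity, and a space and its dual have equal finite dimension.
-/
lemma chartForm_isInvertible {c : M} {x : Model m} (hx : x ∈ (extChartAt (𝓡 m) c).target) :
    (chartForm c x).IsInvertible := by
  have hinj : Function.Injective (chartForm c x).toLinearMap := by
    rw [← LinearMap.ker_eq_bot, LinearMap.ker_eq_bot']
    intro a ha
    by_contra h
    have h1 := chartMetric_pos hx h
    rw [← chartForm_apply] at h1
    have h2 : chartForm c x a = 0 := ha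
    simp only [h2] at h1
    simp at h1
  have hd : Module.finrank ℝ (Model m) = Module.finrank ℝ (Model m →L[ℝ] ℝ) := by
    rw [← (LinearMap.toContinuousLinearMap (𝕜 := ℝ) (E := Model m) (F' := ℝ)).finrank_eq]
    exact (Subspace.dual_finrank_eq (K := ℝ) (V := Model m)).symm
  exact ⟨(LinearEquiv.ofInjectiveOfFinrankEq _ hinj hd).toContinuousLinearEquiv, by ext; rfl⟩

variable [IsContMDiffRiemannianBundle (𝓡 m) ∞ (Model m) (fun x : M => TangentSpace (𝓡 m) x)]

/-- The coefficients are inner products of coordinate vector fields. These fields are smooth, being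
the tangent map of the inverse chart applied to constant fields. -/
lemma chartForm_contDiffOn (c : M) :
    ContDiffOn ℝ ∞ (chartForm c) (extChartAt (𝓡 m) c).target := by
  rw [contDiffOn_clm_apply]
  intro a
  rw [contDiffOn_clm_apply]
  intro b
  have hs (a : Model m) : ContMDiffOn 𝓘(ℝ, Model m) (𝓡 m).tangent ∞
      (fun x => (⟨(extChartAt (𝓡 m) c).symm x,
        mfderiv 𝓘(ℝ, Model m) (𝓡 m) (extChartAt (𝓡 m) c).symm x a⟩ : TangentBundle (𝓡 m) M))
      (extChartAt (𝓡 m) c).target := by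
    have ho : IsOpen (extChartAt (𝓡 m) c).target := isOpen_extChartAt_target c
    have h1 := (contMDiffOn_extChartAt_symm (I := 𝓡 m) (n := ∞) c).contMDiffOn_tangentMapWithin
      (m := ∞) (by simp) ho.uniqueMDiffOn
    have h2 : ContMDiff 𝓘(ℝ, Model m) 𝓘(ℝ, Model m).tangent ∞
        (fun x : Model m => (⟨x, a⟩ : TangentBundle 𝓘(ℝ, Model m) (Model m))) := by
      intro x
      rw [contMDiffAt_totalSpace]
      refine ⟨contMDiffAt_id, ?_⟩
      simp only [trivializationAt_model_space_apply]
      exact contMDiffAt_const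
    refine (h1.comp h2.contMDiffOn (fun x hx => hx)).congr fun x hx => ?_
    simp only [Function.comp, tangentMapWithin]
    rw [mfderivWithin_of_isOpen ho hx]
  exact (ContMDiffOn.inner_bundle (hs a) (hs b)).contDiffOn

lemma chartForm_contDiffAt {c : M} {x : Model m} (hx : x ∈ (extChartAt (𝓡 m) c).target) :
    ContDiffAt ℝ ∞ (chartForm c) x :=
  (chartForm_contDiffOn c).contDiffAt ((isOpen_extChartAt_target c).mem_nhds hx)

lemma fderiv_chartMetric {c : M} {x : Model m} (hx : x ∈ (extChartAt (𝓡 m) c).target)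
    (a b w : Model m) :
    fderiv ℝ (fun y => chartMetric c y a b) x w = fderiv ℝ (chartForm c) x w a b := by
  have h := ((chartForm_contDiffAt hx).differentiableAt (by simp)).hasFDerivAt
  have h2 := (h.clm_apply (hasFDerivAt_const a x)).clm_apply (hasFDerivAt_const b x)
  have := h2.fderiv
  simp only [chartForm_apply] at this
  rw [this]
  simp

/-- The covector `w ↦ Γ_x(v, v; w)`. -/
noncomputable def christoffelForm (c : M) (x v : Model m) : Model m →L[ℝ] ℝ :=
  fderiv ℝ (chartForm c) x v v
    - (1 / 2 : ℝ) • ((fderiv ℝ (chartForm c) x).flip v).flip v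

lemma christoffelForm_apply {c : M} {x : Model m} (hx : x ∈ (extChartAt (𝓡 m) c).target)
    (v w : Model m) : christoffelForm c x v w = christoffel c x v v w := by
  simp only [christoffel, fderiv_chartMetric hx, christoffelForm]
  simp
  ring

/-- The geodesic equation in the chart at `c` reads `x'' = -spray c x x'`. -/
noncomputable def spray (c : M) (x v : Model m) : Model m :=
  (chartForm c x).inverse (christoffelForm c x v)

lemma chartMetric_spray {c : M} {x : Model m} (hx : x ∈ (extChartAt (𝓡 m) c).target)
    (v w : Model m) : chartMetric c x (spray c x v) w = christoffel c x v v w := by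
  rw [← chartForm_apply, spray, ← christoffelForm_apply hx]
  obtain ⟨e, he⟩ := chartForm_isInvertible hx
  rw [← he]
  simp

lemma geodesic_equation_iff {c : M} {x : Model m} (hx : x ∈ (extChartAt (𝓡 m) c).target)
    (a v : Model m) :
    (∀ w, chartMetric c x a w + christoffel c x v v w = 0) ↔ a = -spray c x v := by
  constructor
  · intro h
    by_contra hne
    have hne' : a + spray c x v ≠ 0 := fun h0 => hne (eq_neg_of_add_eq_zero_left h0)
    have := chartMetric_pos hx hne'
    -- Testing the equation against the defect itself contradicts positive definiteness.
    have h2 := h (a + spray c x v)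
    rw [← chartMetric_spray hx, ← chartForm_apply, ← chartForm_apply,
      ← _root_.add_apply, ← map_add, chartForm_apply] at h2
    exact this.ne' h2
  · rintro rfl w
    rw [← chartMetric_spray hx, ← chartForm_apply, ← chartForm_apply,
      ← _root_.add_apply, ← map_add]
    simp

lemma christoffelForm_contDiffAt {c : M} {x : Model m}
    (hx : x ∈ (extChartAt (𝓡 m) c).target) (v : Model m) :
    ContDiffAt ℝ 1 (fun z : Model m × Model m => christoffelForm c z.1 z.2) (x, v) := by
  have ho : IsOpen ((extChartAt (𝓡 m) c).target ×ˢ (univ : Set (Model m))) :=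
    (isOpen_extChartAt_target c).prod isOpen_univ
  refine ContDiffOn.contDiffAt (s := (extChartAt (𝓡 m) c).target ×ˢ univ) ?_
    (ho.mem_nhds ⟨hx, mem_univ v⟩)
  have h1 : ContDiffOn ℝ 1 (fderiv ℝ (chartForm c)) (extChartAt (𝓡 m) c).target :=
    (chartForm_contDiffOn c).fderiv_of_isOpen (isOpen_extChartAt_target c)
      (by norm_cast)
  have h2 : ContDiffOn ℝ 1 (fun z : Model m × Model m => fderiv ℝ (chartForm c) z.1)
      ((extChartAt (𝓡 m) c).target ×ˢ univ) :=
    h1.comp contDiffOn_fst (fun z hz => hz.1)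
  rw [contDiffOn_clm_apply]
  intro w
  have key : ∀ z : Model m × Model m, christoffelForm c z.1 z.2 w =
      fderiv ℝ (chartForm c) z.1 z.2 z.2 w
        - (1 / 2 : ℝ) • fderiv ℝ (chartForm c) z.1 w z.2 z.2 := fun z => rfl
  simp only [key]
  exact (((h2.clm_apply contDiffOn_snd).clm_apply contDiffOn_snd).clm_apply
    contDiffOn_const).sub
    ((((h2.clm_apply contDiffOn_const).clm_apply contDiffOn_snd).clm_apply
      contDiffOn_snd).const_smul _)

/-- Operator inversion is smooth at invertible operators. `C¹` is the regularity that
Picard–Lindelöf and the Lipschitz uniqueness argument need. -/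
lemma spray_contDiffAt {c : M} {x : Model m} (hx : x ∈ (extChartAt (𝓡 m) c).target)
    (v : Model m) :
    ContDiffAt ℝ 1 (fun z : Model m × Model m => spray c z.1 z.2) (x, v) := by
  obtain ⟨e, he⟩ := chartForm_isInvertible hx
  have h1 : ContDiffAt ℝ 1 ContinuousLinearMap.inverse (chartForm c x) := by
    rw [← he]; exact contDiffAt_map_inverse e
  have h2 : ContDiffAt ℝ 1 (fun z : Model m × Model m => chartForm c z.1) (x, v) :=
    ContDiffAt.comp (x, v) (f := Prod.fst)
      ((chartForm_contDiffAt hx).of_le (by exact WithTop.coe_le_coe.2 le_top)) contDiffAt_fst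
  exact (ContDiffAt.comp (x, v) (f := fun z : Model m × Model m => chartForm c z.1) h1 h2).clm_apply
    (christoffelForm_contDiffAt hx v)

end ChartMetric

/-! ### Transformation of the acceleration under a change of coordinates. -/

section CoordinateChange

variable {E : Type*} [NormedAddCommGroup E] [NormedSpace ℝ E]

/-- The derivative of a pulled back bilinear form. -/
lemma fderiv_pullback_form {B B' : E → E →L[ℝ] E →L[ℝ] ℝ} {φ : E → E} {z : E}
    (hφ : ContDiffAt ℝ 2 φ z) (hB : DifferentiableAt ℝ B z) (hB' : DifferentiableAt ℝ B' (φ z))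
    (h : ∀ᶠ y in 𝓝 z, ∀ a b, B y a b = B' (φ y) (fderiv ℝ φ y a) (fderiv ℝ φ y b)) (u a b : E) :
    fderiv ℝ B z u a b =
      fderiv ℝ B' (φ z) (fderiv ℝ φ z u) (fderiv ℝ φ z a) (fderiv ℝ φ z b)
      + B' (φ z) (fderiv ℝ (fderiv ℝ φ) z u a) (fderiv ℝ φ z b)
      + B' (φ z) (fderiv ℝ φ z a) (fderiv ℝ (fderiv ℝ φ) z u b) := by
  have hφ1 : HasFDerivAt φ (fderiv ℝ φ z) z := (hφ.differentiableAt (by simp)).hasFDerivAt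
  have hφ2 : HasFDerivAt (fderiv ℝ φ) (fderiv ℝ (fderiv ℝ φ) z) z :=
    ((hφ.fderiv_right (m := 1) (by norm_num)).differentiableAt (by simp)).hasFDerivAt
  have h1 : HasFDerivAt (fun y => B y a b) _ z :=
    (hB.hasFDerivAt.clm_apply (hasFDerivAt_const a z)).clm_apply (hasFDerivAt_const b z)
  have h2 : HasFDerivAt (fun y => B' (φ y) (fderiv ℝ φ y a) (fderiv ℝ φ y b)) _ z :=
    ((hB'.hasFDerivAt.comp z hφ1).clm_apply (hφ2.clm_apply (hasFDerivAt_const a z))).clm_apply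
      (hφ2.clm_apply (hasFDerivAt_const b z))
  have h3 := h1.congr_of_eventuallyEq
    (f₁ := fun y => B' (φ y) (fderiv ℝ φ y a) (fderiv ℝ φ y b))
    (h.mono fun y hy => (hy a b).symm)
  have := congrArg (fun L => L u) (h3.unique h2)
  simp at this
  linarith

/-- The covariant acceleration does not depend on the coordinates. -/
lemma covariant_acceleration_coordinate_change {B B' : E → E →L[ℝ] E →L[ℝ] ℝ} {φ : E → E} {z : E}
    (hφ : ContDiffAt ℝ 2 φ z) (hB : DifferentiableAt ℝ B z) (hB' : DifferentiableAt ℝ B' (φ z))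
    (hsymm : ∀ a b, B' (φ z) a b = B' (φ z) b a)
    (h : ∀ᶠ y in 𝓝 z, ∀ a b, B y a b = B' (φ y) (fderiv ℝ φ y a) (fderiv ℝ φ y b)) (a v w : E) :
    B z a w + (fderiv ℝ B z v v w + fderiv ℝ B z v v w - fderiv ℝ B z w v v) / 2 =
      B' (φ z) (fderiv ℝ (fderiv ℝ φ) z v v + fderiv ℝ φ z a) (fderiv ℝ φ z w)
      + (fderiv ℝ B' (φ z) (fderiv ℝ φ z v) (fderiv ℝ φ z v) (fderiv ℝ φ z w)
        + fderiv ℝ B' (φ z) (fderiv ℝ φ z v) (fderiv ℝ φ z v) (fderiv ℝ φ z w)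
        - fderiv ℝ B' (φ z) (fderiv ℝ φ z w) (fderiv ℝ φ z v) (fderiv ℝ φ z v)) / 2 := by
  -- By symmetry of `D²φ` and of `B'`, the terms with `D²φ(v, w)` cancel in Koszul's formula. Only
  -- `B'(D²φ(v, v), Dφ w)` survives, and it is exactly the correction to the acceleration.
  have hs : fderiv ℝ (fderiv ℝ φ) z w v = fderiv ℝ (fderiv ℝ φ) z v w :=
    hφ.isSymmSndFDerivAt (by simp) w v
  rw [h.self_of_nhds a w, fderiv_pullback_form hφ hB hB' h, fderiv_pullback_form hφ hB hB' h, hs,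
    hsymm (fderiv ℝ φ z v) (fderiv ℝ (fderiv ℝ φ) z v w), map_add, add_apply]
  ring

/-- The second derivative of a composition. -/
lemma deriv_deriv_comp {φ : E → E} {x : ℝ → E} {t : ℝ} (hφ : ContDiffAt ℝ 2 φ (x t))
    (hx : ContDiffAt ℝ 2 x t) :
    deriv (fun s => φ (x s)) t = fderiv ℝ φ (x t) (deriv x t) ∧
    deriv (deriv (fun s => φ (x s))) t =
      fderiv ℝ (fderiv ℝ φ) (x t) (deriv x t) (deriv x t)
        + fderiv ℝ φ (x t) (deriv (deriv x) t) := by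
  have h1 : ∀ᶠ s in 𝓝 t, deriv (fun s => φ (x s)) s = fderiv ℝ φ (x s) (deriv x s) := by
    have e1 : ∀ᶠ s in 𝓝 t, ContDiffAt ℝ 2 φ (x s) :=
      hx.continuousAt.eventually (hφ.eventually (by simp))
    filter_upwards [e1, hx.eventually (by simp)] with s hs1 hs2
    exact ((hs1.differentiableAt (by simp)).hasFDerivAt.comp_hasDerivAt s
      (hs2.differentiableAt (by simp)).hasDerivAt).deriv
  refine ⟨h1.self_of_nhds, ?_⟩
  rw [EventuallyEq.deriv_eq (f := fun s => fderiv ℝ φ (x s) (deriv x s)) h1]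
  have hφ2 : HasFDerivAt (fderiv ℝ φ) (fderiv ℝ (fderiv ℝ φ) (x t)) (x t) :=
    ((hφ.fderiv_right (m := 1) (by norm_num)).differentiableAt (by simp)).hasFDerivAt
  have hx1 := (hx.differentiableAt (by simp)).hasDerivAt
  have hx2 : HasDerivAt (deriv x) (deriv (deriv x) t) t :=
    ((hx.derivWithin (m := 1) (by norm_num)).differentiableAt (by simp)).hasDerivAt
  exact ((hφ2.comp_hasDerivAt t hx1).clm_apply hx2).deriv

end CoordinateChange
-- Coordinates on the manifold and its tangent bundle; chart independence of the geodesic equation.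
section Coordinates

variable {m : ℕ} {M : Type*} [MetricSpace M] [ChartedSpace (Model m) M]

/-- The coordinates of a curve in the chart at `c`. -/
noncomputable def coord (m : ℕ) {M : Type*} [MetricSpace M] [ChartedSpace (Model m) M]
    (c : M) (γ : ℝ → M) (s : ℝ) : Model m := extChartAt (𝓡 m) c (γ s)

/-- The coordinates of a tangent vector in the chart at `c`. -/
noncomputable def phase (c : M) (P : TangentBundle (𝓡 m) M) : Model m × Model m :=
  (extChartAt (𝓡 m) c P.1, mfderiv (𝓡 m) 𝓘(ℝ, Model m) (extChartAt (𝓡 m) c) P.1 P.2)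

/-- The tangent vector with given coordinates in the chart at `c`. -/
noncomputable def unphase (c : M) (z : Model m × Model m) : TangentBundle (𝓡 m) M :=
  ⟨(extChartAt (𝓡 m) c).symm z.1,
    mfderiv 𝓘(ℝ, Model m) (𝓡 m) (extChartAt (𝓡 m) c).symm z.1 z.2⟩

lemma coord_mem_target {c : M} {γ : ℝ → M} {t : ℝ} (h : γ t ∈ (extChartAt (𝓡 m) c).source) :
    coord m c γ t ∈ (extChartAt (𝓡 m) c).target :=
  (extChartAt (𝓡 m) c).map_source h

variable [IsManifold (𝓡 m) ∞ M]

lemma mdifferentiableAt_extChartAt_symm {c : M} {x : Model m}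
    (hx : x ∈ (extChartAt (𝓡 m) c).target) :
    MDifferentiableAt 𝓘(ℝ, Model m) (𝓡 m) (extChartAt (𝓡 m) c).symm x :=
  ((contMDiffOn_extChartAt_symm (I := 𝓡 m) (n := ∞) c).contMDiffAt
    ((isOpen_extChartAt_target c).mem_nhds hx)).mdifferentiableAt (by simp)

lemma mfderiv_symm_mfderiv_extChartAt {c p : M} (hp : p ∈ (extChartAt (𝓡 m) c).source)
    (v : TangentSpace (𝓡 m) p) :
    (mfderiv 𝓘(ℝ, Model m) (𝓡 m) (extChartAt (𝓡 m) c).symm (extChartAt (𝓡 m) c p)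
      (mfderiv (𝓡 m) 𝓘(ℝ, Model m) (extChartAt (𝓡 m) c) p v) : Model m) = v := by
  have h := mfderivWithin_extChartAt_symm_comp_mfderiv_extChartAt' (I := 𝓡 m) (x := c) hp
  simp only [modelWithCornersSelf_coe, range_id, mfderivWithin_univ] at h
  exact congrArg (fun L => L v) h

lemma mfderiv_extChartAt_mfderiv_symm {c : M} {x : Model m}
    (hx : x ∈ (extChartAt (𝓡 m) c).target) (v : Model m) :
    (mfderiv (𝓡 m) 𝓘(ℝ, Model m) (extChartAt (𝓡 m) c) ((extChartAt (𝓡 m) c).symm x)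
      (mfderiv 𝓘(ℝ, Model m) (𝓡 m) (extChartAt (𝓡 m) c).symm x v) : Model m) = v := by
  have h := mfderiv_extChartAt_comp_mfderivWithin_extChartAt_symm (I := 𝓡 m) (x := c) hx
  simp only [modelWithCornersSelf_coe, range_id, mfderivWithin_univ] at h
  exact congrArg (fun L => L v) h

lemma unphase_phase {c : M} {P : TangentBundle (𝓡 m) M}
    (hP : P.1 ∈ (extChartAt (𝓡 m) c).source) : unphase c (phase c P) = P := by
  obtain ⟨p, v⟩ := P
  have h := mfderiv_symm_mfderiv_extChartAt hP v
  simp only [unphase, phase]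
  have e : (extChartAt (𝓡 m) c).symm (extChartAt (𝓡 m) c p) = p :=
    (extChartAt (𝓡 m) c).left_inv hP
  -- All tangent spaces unfold to the same model space, so an equality there suffices.
  exact Bundle.TotalSpace.ext e (heq_of_eq h)

lemma phase_unphase {c : M} {z : Model m × Model m}
    (hz : z.1 ∈ (extChartAt (𝓡 m) c).target) : phase c (unphase (M := M) c z) = z :=
  Prod.ext ((extChartAt (𝓡 m) c).right_inv hz) (mfderiv_extChartAt_mfderiv_symm hz z.2)

lemma coord_contDiffAt {c : M} {γ : ℝ → M} {t : ℝ} {n : ℕ∞} (hγ : ContMDiffAt 𝓘(ℝ, ℝ) (𝓡 m) n γ t)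
    (h : γ t ∈ (extChartAt (𝓡 m) c).source) : ContDiffAt ℝ n (coord m c γ) t := by
  rw [← contMDiffAt_iff_contDiffAt]
  rw [extChartAt_source] at h
  have := (contMDiffAt_extChartAt' (I := 𝓡 m) (n := ∞) h).of_le
    (m := n) (by exact WithTop.coe_le_coe.2 le_top)
  exact this.comp t hγ

lemma phase_velocity {c : M} {γ : ℝ → M} {t : ℝ} (hγ : MDifferentiableAt 𝓘(ℝ, ℝ) (𝓡 m) γ t)
    (h : γ t ∈ (extChartAt (𝓡 m) c).source) :
    phase c (velocity m γ t) = (coord m c γ t, deriv (coord m c γ) t) := by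
  refine Prod.ext rfl ?_
  rw [← fderiv_apply_one_eq_deriv, ← mfderiv_eq_fderiv]
  have h' := h
  rw [extChartAt_source] at h'
  have := mfderiv_comp t (mdifferentiableAt_extChartAt (I := 𝓡 m) h') hγ
  exact (congrArg (fun L => L (1 : ℝ)) this).symm

/-- Two charts are related by a smooth coordinate change. -/
lemma coordinate_change {c d p : M} (hc : p ∈ (extChartAt (𝓡 m) c).source)
    (hd : p ∈ (extChartAt (𝓡 m) d).source) :
    ∀ᶠ y in 𝓝 (extChartAt (𝓡 m) c p),
      y ∈ (extChartAt (𝓡 m) c).target ∧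
      (extChartAt (𝓡 m) c).symm y ∈ (extChartAt (𝓡 m) d).source ∧
      ContDiffAt ℝ ∞ (fun y => extChartAt (𝓡 m) d ((extChartAt (𝓡 m) c).symm y)) y ∧
      ∀ a, fderiv ℝ (fun y => extChartAt (𝓡 m) d ((extChartAt (𝓡 m) c).symm y)) y a =
        (mfderiv (𝓡 m) 𝓘(ℝ, Model m) (extChartAt (𝓡 m) d) ((extChartAt (𝓡 m) c).symm y)
          (mfderiv 𝓘(ℝ, Model m) (𝓡 m) (extChartAt (𝓡 m) c).symm y a) : Model m) := by
  have h1 : (extChartAt (𝓡 m) c).target ∈ 𝓝 (extChartAt (𝓡 m) c p) :=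
    (isOpen_extChartAt_target c).mem_nhds ((extChartAt (𝓡 m) c).map_source hc)
  have h2 : ∀ᶠ y in 𝓝 (extChartAt (𝓡 m) c p),
      (extChartAt (𝓡 m) c).symm y ∈ (extChartAt (𝓡 m) d).source := by
    have : ContinuousAt (extChartAt (𝓡 m) c).symm (extChartAt (𝓡 m) c p) :=
      continuousAt_extChartAt_symm' hc
    refine this.eventually ((isOpen_extChartAt_source d).mem_nhds ?_)
    rwa [(extChartAt (𝓡 m) c).left_inv hc]
  filter_upwards [h1, h2] with y hy1 hy2
  refine ⟨hy1, hy2, ?_, fun a => ?_⟩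
  · have h3 := (contMDiffOn_extChartAt_symm (I := 𝓡 m) (n := ∞) c).contMDiffAt
      ((isOpen_extChartAt_target c).mem_nhds hy1)
    have hy2' := hy2
    rw [extChartAt_source] at hy2'
    exact contMDiffAt_iff_contDiffAt.1
      (ContMDiffAt.comp y (contMDiffAt_extChartAt' (I := 𝓡 m) (n := ∞) hy2') h3)
  · have hy2' := hy2
    rw [extChartAt_source] at hy2'
    rw [← mfderiv_eq_fderiv]
    exact congrArg (fun L => L a) (mfderiv_comp y
      (mdifferentiableAt_extChartAt (I := 𝓡 m) hy2') (mdifferentiableAt_extChartAt_symm hy1))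

variable [RiemannianBundle (fun x : M => TangentSpace (𝓡 m) x)]

lemma chartMetric_phase {c p : M} (hp : p ∈ (extChartAt (𝓡 m) c).source)
    (v w : TangentSpace (𝓡 m) p) :
    chartMetric c (phase c ⟨p, v⟩).1 (phase c ⟨p, v⟩).2 (phase c ⟨p, w⟩).2 = inner ℝ v w := by
  have h (v : TangentSpace (𝓡 m) p) := unphase_phase (P := ⟨p, v⟩) hp
  -- The base point of `unphase` equals `p` only propositionally, so the inner product is
  -- transported along equalities in the total space.
  have key : ∀ (q : M) (a b : TangentSpace (𝓡 m) q), (⟨q, a⟩ : TangentBundle (𝓡 m) M) = ⟨p, v⟩ →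
      (⟨q, b⟩ : TangentBundle (𝓡 m) M) = ⟨p, w⟩ → inner ℝ a b = inner ℝ v w := by
    intro q a b h1 h2
    cases h1
    cases h2
    rfl
  exact key _ _ _ (h v) (h w)

lemma chartMetric_coordinate_change {c d p : M} (hc : p ∈ (extChartAt (𝓡 m) c).source)
    (hd : p ∈ (extChartAt (𝓡 m) d).source) :
    ∀ᶠ y in 𝓝 (extChartAt (𝓡 m) c p), ∀ a b, chartForm c y a b =
      chartForm d (extChartAt (𝓡 m) d ((extChartAt (𝓡 m) c).symm y))
        (fderiv ℝ (fun y => extChartAt (𝓡 m) d ((extChartAt (𝓡 m) c).symm y)) y a)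
        (fderiv ℝ (fun y => extChartAt (𝓡 m) d ((extChartAt (𝓡 m) c).symm y)) y b) := by
  filter_upwards [coordinate_change hc hd] with y ⟨h1, h2, h3, h4⟩ a b
  rw [h4, h4]
  exact (chartMetric_phase h2 (mfderiv 𝓘(ℝ, Model m) (𝓡 m) (extChartAt (𝓡 m) c).symm y a)
    (mfderiv 𝓘(ℝ, Model m) (𝓡 m) (extChartAt (𝓡 m) c).symm y b)).symm

variable [IsContMDiffRiemannianBundle (𝓡 m) ∞ (Model m) (fun x : M => TangentSpace (𝓡 m) x)]

lemma chartAcceleration_coordinate_change {c d : M} {γ : ℝ → M} {t : ℝ}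
    (hγ : ContMDiffAt 𝓘(ℝ, ℝ) (𝓡 m) 2 γ t) (hc : γ t ∈ (extChartAt (𝓡 m) c).source)
    (hd : γ t ∈ (extChartAt (𝓡 m) d).source) (h : ∀ w : Model m, chartAcceleration c γ t w = 0)
    (w : Model m) : chartAcceleration d γ t w = 0 := by
  have hcc := (coordinate_change hc hd).self_of_nhds
  obtain ⟨hz, hzd, hφ, hφ1⟩ := hcc
  set φ : Model m → Model m := fun y => extChartAt (𝓡 m) d ((extChartAt (𝓡 m) c).symm y) with hφdef
  set x : ℝ → Model m := coord m c γ with hx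
  have hφ2 : ContDiffAt ℝ 2 φ (x t) := hφ.of_le (by norm_cast)
  have hx2 : ContDiffAt ℝ 2 x t := coord_contDiffAt (n := 2) hγ hc
  have hφx : φ (x t) = coord m d γ t := by
    simp only [hφdef, hx, coord, (extChartAt (𝓡 m) c).left_inv hc]
  have hy : coord m d γ =ᶠ[𝓝 t] fun s => φ (x s) := by
    filter_upwards [hγ.continuousAt.eventually ((isOpen_extChartAt_source c).mem_nhds hc)] with s hs
    simp only [hφdef, hx, coord, (extChartAt (𝓡 m) c).left_inv hs]
  have hdt : coord m d γ t ∈ (extChartAt (𝓡 m) d).target := coord_mem_target hd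
  have hct : x t ∈ (extChartAt (𝓡 m) c).target := coord_mem_target hc
  -- The differential of the transition map is onto, so every test vector in the chart at `d` comes
  -- from one in the chart at `c`.
  obtain ⟨w', rfl⟩ : ∃ w', fderiv ℝ φ (x t) w' = w := by
    have hw := mfderiv_extChartAt_mfderiv_symm hdt w
    refine ⟨mfderiv (𝓡 m) 𝓘(ℝ, Model m) (extChartAt (𝓡 m) c) (γ t)
      (mfderiv 𝓘(ℝ, Model m) (𝓡 m) (extChartAt (𝓡 m) d).symm (coord m d γ t) w), ?_⟩
    have hp : (extChartAt (𝓡 m) d).symm (coord m d γ t) = γ t := (extChartAt (𝓡 m) d).left_inv hd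
    have hp' : (extChartAt (𝓡 m) c).symm (coord m c γ t) = γ t := (extChartAt (𝓡 m) c).left_inv hc
    refine (hφ1 _).trans ?_
    rw [show extChartAt (𝓡 m) c (γ t) = coord m c γ t from rfl] at *
    have e1 := mfderiv_symm_mfderiv_extChartAt hc (mfderiv 𝓘(ℝ, Model m) (𝓡 m)
      (extChartAt (𝓡 m) d).symm (coord m d γ t) w : Model m)
    refine Eq.trans ?_ hw
    rw [hp', hp]
    exact congrArg _ e1
  have hdd := deriv_deriv_comp hφ2 hx2
  have e1 : deriv (coord m d γ) t = fderiv ℝ φ (x t) (deriv x t) := hy.deriv_eq.trans hdd.1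
  have e2 : deriv (deriv (coord m d γ)) t = fderiv ℝ (fderiv ℝ φ) (x t) (deriv x t) (deriv x t)
        + fderiv ℝ φ (x t) (deriv (deriv x) t) := hy.deriv.deriv_eq.trans hdd.2
  have key := covariant_acceleration_coordinate_change (B := chartForm c) (B' := chartForm d) hφ2
    ((chartForm_contDiffAt hct).differentiableAt (by simp))
    ((chartForm_contDiffAt (hφx ▸ hdt)).differentiableAt (by simp))
    (fun a b => chartMetric_comm _ _ _ _) (chartMetric_coordinate_change hc hd)
    (deriv (deriv x) t) (deriv x t) w'
  have hw := h w'
  change chartMetric c (x t) (deriv (deriv x) t) w' + christoffel c (x t) (deriv x t) (deriv x t) w'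
    = 0 at hw
  change chartMetric d (coord m d γ t) (deriv (deriv (coord m d γ)) t) _
    + christoffel d (coord m d γ t) (deriv (coord m d γ) t) (deriv (coord m d γ) t) _ = 0
  rw [e1, e2]
  simp only [christoffel, fderiv_chartMetric hct] at hw
  rw [← hφx] at hdt ⊢
  simp only [christoffel, fderiv_chartMetric hdt]
  simp only [chartForm_apply] at key
  rw [← key]
  exact hw

end Coordinates
-- Pointwise geodesic equation, affine reparametrization and uniqueness.
section GeodesicAt

variable {m : ℕ} {M : Type*} [MetricSpace M] [ChartedSpace (Model m) M]

lemma velocity_congr {γ η : ℝ → M} {t : ℝ} (he : γ =ᶠ[𝓝 t] η) :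
    velocity m γ t = velocity m η t := by
  refine Bundle.TotalSpace.ext he.eq_of_nhds ?_
  have h := he.mfderiv_eq (I := 𝓘(ℝ, ℝ)) (I' := 𝓡 m)
  exact heq_of_eq (congrArg (fun L => L (1 : ℝ)) h)

variable [RiemannianBundle (fun x : M => TangentSpace (𝓡 m) x)]

/-- The curve `γ` is `C²` at time `t` and satisfies the geodesic equation there. -/
def IsGeodesicAt (m : ℕ) {M : Type*} [MetricSpace M] [ChartedSpace (Model m) M]
    [RiemannianBundle (fun x : M => TangentSpace (𝓡 m) x)] (γ : ℝ → M) (t : ℝ) : Prop :=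
  ContMDiffAt 𝓘(ℝ, ℝ) (𝓡 m) 2 γ t ∧
    ∀ c : M, γ t ∈ (extChartAt (𝓡 m) c).source →
      ∀ w : Model m, chartAcceleration c γ t w = 0

lemma isGeodesic_iff {γ : ℝ → M} : IsGeodesic m γ ↔ ∀ t, IsGeodesicAt m γ t :=
  ⟨fun h t => ⟨h.1 t, fun c => h.2 c t⟩, fun h => ⟨fun t => (h t).1, fun c t => (h t).2 c⟩⟩

lemma chartAcceleration_eq (c : M) (γ : ℝ → M) (t : ℝ) (w : Model m) :
    chartAcceleration c γ t w =
      chartMetric c (coord m c γ t) (deriv (deriv (coord m c γ)) t) w +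
        christoffel c (coord m c γ t) (deriv (coord m c γ) t) (deriv (coord m c γ) t) w := rfl

lemma IsGeodesicAt.congr {γ η : ℝ → M} {t : ℝ} (h : IsGeodesicAt m γ t) (he : γ =ᶠ[𝓝 t] η) :
    IsGeodesicAt m η t := by
  refine ⟨h.1.congr_of_eventuallyEq he.symm, fun c hc w => ?_⟩
  rw [← he.eq_of_nhds] at hc
  have hx : coord m c γ =ᶠ[𝓝 t] coord m c η := by
    filter_upwards [he] with s hs
    simp only [coord, hs]
  have := h.2 c hc w
  rw [chartAcceleration_eq] at this ⊢
  rwa [← hx.eq_of_nhds, ← hx.deriv_eq, ← hx.deriv.deriv_eq]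

/-- Both terms of the acceleration scale by `a²`. The uses are time translation (`a = 1`) and time
reversal (`a = -1`). -/
lemma IsGeodesicAt.comp_affine {γ : ℝ → M} (a b : ℝ) {t : ℝ} (h : IsGeodesicAt m γ (a * t + b)) :
    IsGeodesicAt m (fun s => γ (a * s + b)) t := by
  have hg : ContMDiffAt 𝓘(ℝ, ℝ) 𝓘(ℝ, ℝ) 2 (fun s : ℝ => a * s + b) t := by
    rw [contMDiffAt_iff_contDiffAt]
    fun_prop
  refine ⟨ContMDiffAt.comp t h.1 hg, fun c hc w => ?_⟩
  have hx := h.2 c hc w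
  rw [chartAcceleration_eq] at hx ⊢
  have hd (f : ℝ → Model m) : deriv (fun s => f (a * s + b)) = fun s => a • deriv f (a * s + b) := by
    ext1 s
    have h1 := deriv_comp_mul_left a (fun u => f (u + b)) s
    rw [h1, deriv_comp_add_const]
  have e1 : coord m c (fun s => γ (a * s + b)) = fun s => coord m c γ (a * s + b) := rfl
  have e2 : deriv (fun s => a • deriv (coord m c γ) (a * s + b)) t
      = (a * a) • deriv (deriv (coord m c γ)) (a * t + b) := by
    rw [deriv_fun_const_smul_field, hd, smul_smul]
  rw [e1, hd, e2]
  simp only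
  have e3 (y u v : Model m) : chartMetric c y (a • u) v = a * chartMetric c y u v := by
    simp only [← chartForm_apply, map_smul]; rfl
  have e4 (y u v : Model m) : chartMetric c y u (a • v) = a * chartMetric c y u v := by
    rw [chartMetric_comm, e3, chartMetric_comm]
  have e5 : chartMetric c (coord m c γ (a * t + b)) ((a * a) • deriv (deriv (coord m c γ)) (a * t + b)) w
      = (a * a) * chartMetric c (coord m c γ (a * t + b)) (deriv (deriv (coord m c γ)) (a * t + b)) w := by
    simp only [← chartForm_apply, map_smul]; rfl
  have e6 (f : Model m → ℝ) (y : Model m) : fderiv ℝ (fun z => a * f z) y = a • fderiv ℝ f y :=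
    congrFun (fderiv_const_smul_field (f := f) a) y
  have e7 (y u : Model m) : christoffel c y (a • u) (a • u) w = (a * a) * christoffel c y u u w := by
    simp only [christoffel, e3, e4, e6, map_smul, smul_apply, smul_eq_mul]
    ring
  rw [e5, e7, ← mul_add, hx, mul_zero]

lemma velocity_comp_affine {γ : ℝ → M} (a b : ℝ) {t : ℝ} (h : IsGeodesicAt m γ (a * t + b)) :
    velocity m (fun s => γ (a * s + b)) t =
      ⟨γ (a * t + b), a • mfderiv 𝓘(ℝ, ℝ) (𝓡 m) γ (a * t + b) (1 : ℝ)⟩ := by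
  refine Bundle.TotalSpace.ext rfl (heq_of_eq ?_)
  have hd : HasDerivAt (fun s : ℝ => a * s + b) a t := by
    simpa using ((hasDerivAt_id t).const_mul a).add_const b
  have hg : HasMFDerivAt 𝓘(ℝ, ℝ) 𝓘(ℝ, ℝ) (fun s : ℝ => a * s + b) t _ :=
    hd.hasFDerivAt.hasMFDerivAt
  have h1 := HasMFDerivAt.comp t (h.1.mdifferentiableAt (by simp)).hasMFDerivAt hg
  have h2 := congrArg (fun L => L (1 : ℝ)) h1.mfderiv
  refine Eq.trans h2 ?_
  change (mfderiv 𝓘(ℝ, ℝ) (𝓡 m) γ (a * t + b)) ((1 : ℝ) • a) = _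
  refine Eq.trans ?_ (ContinuousLinearMap.map_smul _ a (1 : ℝ))
  exact congrArg (mfderiv 𝓘(ℝ, ℝ) (𝓡 m) γ (a * t + b)) (mul_comm (1 : ℝ) a)

variable [IsManifold (𝓡 m) ∞ M]

lemma IsGeodesicAt.phase_velocity {c : M} {γ : ℝ → M} {t : ℝ} (h : IsGeodesicAt m γ t)
    (hc : γ t ∈ (extChartAt (𝓡 m) c).source) :
    phase c (velocity m γ t) = (coord m c γ t, deriv (coord m c γ) t) :=
  ParetoDescent.phase_velocity (h.1.mdifferentiableAt (by simp)) hc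

variable [IsContMDiffRiemannianBundle (𝓡 m) ∞ (Model m) (fun x : M => TangentSpace (𝓡 m) x)]

/-- It suffices to check the geodesic equation in one chart. -/
lemma isGeodesicAt_of_chart {c : M} {γ : ℝ → M} {t : ℝ}
    (hγ : ContMDiffAt 𝓘(ℝ, ℝ) (𝓡 m) 2 γ t) (hc : γ t ∈ (extChartAt (𝓡 m) c).source)
    (h : deriv (deriv (coord m c γ)) t = -spray c (coord m c γ t) (deriv (coord m c γ) t)) :
    IsGeodesicAt m γ t :=
  ⟨hγ, fun _ hd => chartAcceleration_coordinate_change hγ hc hd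
    ((geodesic_equation_iff (coord_mem_target hc) _ _).2 h)⟩

lemma IsGeodesicAt.hasDerivAt_coord {c : M} {γ : ℝ → M} {t : ℝ} (h : IsGeodesicAt m γ t)
    (hc : γ t ∈ (extChartAt (𝓡 m) c).source) :
    HasDerivAt (fun s => (coord m c γ s, deriv (coord m c γ) s))
      (deriv (coord m c γ) t, -spray c (coord m c γ t) (deriv (coord m c γ) t)) t := by
  have hx : ContDiffAt ℝ 2 (coord m c γ) t := coord_contDiffAt (n := 2) h.1 hc
  have e : deriv (deriv (coord m c γ)) t = -spray c (coord m c γ t) (deriv (coord m c γ) t) :=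
    (geodesic_equation_iff (coord_mem_target hc) _ _).1 (h.2 c hc)
  rw [← e]
  have hx2 : ContDiffAt ℝ 1 (deriv (coord m c γ)) t := hx.derivWithin (by norm_num)
  exact (hx.differentiableAt (by simp)).hasDerivAt.prodMk
    (hx2.differentiableAt (by simp)).hasDerivAt

lemma phaseField_contDiffAt {c : M} {z : Model m × Model m}
    (hz : z.1 ∈ (extChartAt (𝓡 m) c).target) :
    ContDiffAt ℝ 1 (fun z : Model m × Model m => (z.2, -spray c z.1 z.2)) z :=
  contDiffAt_snd.prodMk (spray_contDiffAt hz z.2).neg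

/-- Local uniqueness of geodesics. -/
lemma eventuallyEq_of_isGeodesicAt {γ η : ℝ → M} {t : ℝ}
    (hγ : ∀ᶠ s in 𝓝 t, IsGeodesicAt m γ s) (hη : ∀ᶠ s in 𝓝 t, IsGeodesicAt m η s)
    (h : velocity m γ t = velocity m η t) : γ =ᶠ[𝓝 t] η := by
  set c := γ t with hcdef
  have h0 : γ t = η t := congrArg TotalSpace.proj h
  have hsrc : (extChartAt (𝓡 m) c).source ∈ 𝓝 (γ t) := extChartAt_source_mem_nhds c
  have hγs : ∀ᶠ s in 𝓝 t, γ s ∈ (extChartAt (𝓡 m) c).source :=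
    hγ.self_of_nhds.1.continuousAt.eventually hsrc
  have hηs : ∀ᶠ s in 𝓝 t, η s ∈ (extChartAt (𝓡 m) c).source :=
    hη.self_of_nhds.1.continuousAt.eventually (h0 ▸ hsrc)
  set z := phase c (velocity m γ t) with hz
  have hzt : z.1 ∈ (extChartAt (𝓡 m) c).target := coord_mem_target hγs.self_of_nhds
  obtain ⟨K, S, hS, hK⟩ := (phaseField_contDiffAt hzt).exists_lipschitzOnWith
  have aux : ∀ {α : ℝ → M}, (∀ᶠ s in 𝓝 t, IsGeodesicAt m α s) →
      (∀ᶠ s in 𝓝 t, α s ∈ (extChartAt (𝓡 m) c).source) → phase c (velocity m α t) = z →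
      ∀ᶠ s in 𝓝 t, HasDerivAt (fun s => (coord m c α s, deriv (coord m c α) s))
        (deriv (coord m c α) s, -spray c (coord m c α s) (deriv (coord m c α) s)) s ∧
        (coord m c α s, deriv (coord m c α) s) ∈ S := by
    intro α h1 h2 h3
    have hd := h1.self_of_nhds.hasDerivAt_coord h2.self_of_nhds
    have h4 := h1.self_of_nhds.phase_velocity h2.self_of_nhds
    rw [h3] at h4
    have hSα : S ∈ 𝓝 (coord m c α t, deriv (coord m c α) t) := by rwa [← h4]
    filter_upwards [h1, h2, hd.continuousAt.eventually hSα] with s hs1 hs2 hs3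
    exact ⟨hs1.hasDerivAt_coord hs2, hs3⟩
  have key := ODE_solution_unique_of_eventually (t₀ := t) (s := fun _ => S)
    (v := fun _ => fun z : Model m × Model m => (z.2, -spray c z.1 z.2))
    (f := fun s => (coord m c γ s, deriv (coord m c γ) s))
    (g := fun s => (coord m c η s, deriv (coord m c η) s)) (K := K)
    (Eventually.of_forall fun _ => hK) (aux hγ hγs rfl) (aux hη hηs (by rw [hz, h])) (by
      have e1 := hγ.self_of_nhds.phase_velocity hγs.self_of_nhds
      have e2 := hη.self_of_nhds.phase_velocity hηs.self_of_nhds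
      rw [← e1, ← e2, h])
  filter_upwards [key, hγs, hηs] with s hs h1 h2
  exact (extChartAt (𝓡 m) c).injOn h1 h2 (congrArg Prod.fst hs)

/-- Uniqueness of geodesics on intervals. -/
lemma eqOn_of_isGeodesicAt {γ η : ℝ → M} {s : Set ℝ} (ho : IsOpen s) (hs : IsPreconnected s)
    (hγ : ∀ t ∈ s, IsGeodesicAt m γ t) (hη : ∀ t ∈ s, IsGeodesicAt m η t) {t₀ : ℝ} (ht₀ : t₀ ∈ s)
    (h : velocity m γ t₀ = velocity m η t₀) : EqOn γ η s := by
  have hev {α : ℝ → M} (hα : ∀ t ∈ s, IsGeodesicAt m α t) {t : ℝ} (ht : t ∈ s) :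
      ∀ᶠ u in 𝓝 t, IsGeodesicAt m α u :=
    Filter.mem_of_superset (ho.mem_nhds ht) hα
  -- Connectedness argument: `A` is open, and it is closed in `s` because positions and coordinate
  -- velocities agree in the limit, so that local uniqueness applies again.
  set A : Set ℝ := {t | γ =ᶠ[𝓝 t] η} with hA
  have hAo : IsOpen A := by
    rw [isOpen_iff_mem_nhds]
    intro t ht
    exact eventually_eventuallyEq_nhds.2 ht
  have hsub : s ⊆ A := by
    refine hs.subset_of_closure_inter_subset hAo
      ⟨t₀, ht₀, eventuallyEq_of_isGeodesicAt (hev hγ ht₀) (hev hη ht₀) h⟩ ?_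
    rintro t ⟨htA, hts⟩
    refine eventuallyEq_of_isGeodesicAt (hev hγ hts) (hev hη hts) ?_
    have hfr : ∃ᶠ u in 𝓝 t, γ =ᶠ[𝓝 u] η := mem_closure_iff_frequently.1 htA
    have h0 : γ t = η t := by
      exact tendsto_nhds_unique_of_frequently_eq (hγ t hts).1.continuousAt
        (hη t hts).1.continuousAt (hfr.mono fun u hu => hu.eq_of_nhds)
    have hc1 : γ t ∈ (extChartAt (𝓡 m) (γ t)).source := mem_extChartAt_source _
    have hc2 : η t ∈ (extChartAt (𝓡 m) (γ t)).source := h0 ▸ hc1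
    have e : (coord m (γ t) γ t, deriv (coord m (γ t) γ) t) =
        (coord m (γ t) η t, deriv (coord m (γ t) η) t) := by
      refine tendsto_nhds_unique_of_frequently_eq
        ((hγ t hts).hasDerivAt_coord hc1).continuousAt
        ((hη t hts).hasDerivAt_coord hc2).continuousAt (hfr.mono fun u hu => ?_)
      have hx : coord m (γ t) γ =ᶠ[𝓝 u] coord m (γ t) η := by
        filter_upwards [hu] with s hs
        simp only [coord, hs]
      exact Prod.ext hx.eq_of_nhds hx.deriv_eq
    rw [← (hγ t hts).phase_velocity hc1, ← (hη t hts).phase_velocity hc2] at e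
    rw [← unphase_phase (P := velocity m γ t) hc1, e, unphase_phase hc2]
  exact fun t ht => (hsub ht).eq_of_nhds

end GeodesicAt
-- Regularity of ODE solutions, gluing of curves, length.
lemma contDiffOn_fst_of_second_order {E : Type*} [NormedAddCommGroup E] [NormedSpace ℝ E]
    {y : ℝ → E × E} {g : E × E → E} {J : Set ℝ} (hJ : IsOpen J)
    (h : ∀ t ∈ J, HasDerivAt y ((y t).2, g (y t)) t) (hg : ∀ t ∈ J, ContinuousAt g (y t)) :
    ContDiffOn ℝ 2 (fun t => (y t).1) J := by
  -- Bootstrapping: `y` is `C¹` because its derivative is continuous; then the first component has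
  -- the `C¹` derivative `(y t).2`.
  have hy1 : ContDiffOn ℝ 1 y J := by
    rw [show (1 : WithTop ℕ∞) = 0 + 1 from rfl, contDiffOn_succ_iff_deriv_of_isOpen hJ]
    refine ⟨fun t ht => (h t ht).differentiableAt.differentiableWithinAt, by simp, ?_⟩
    rw [contDiffOn_zero]
    refine ContinuousOn.congr (f := fun t => ((y t).2, g (y t))) (fun t ht => ?_)
      (fun t ht => (h t ht).deriv)
    have hc := (h t ht).continuousAt
    exact (hc.snd.prodMk (ContinuousAt.comp (f := y) (hg t ht) hc)).continuousWithinAt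
  rw [show (2 : WithTop ℕ∞) = 1 + 1 from rfl, contDiffOn_succ_iff_deriv_of_isOpen hJ]
  have hd : ∀ t ∈ J, HasDerivAt (fun t => (y t).1) (y t).2 t := fun t ht => (h t ht).fst
  refine ⟨fun t ht => (hd t ht).differentiableAt.differentiableWithinAt, by simp, ?_⟩
  exact (contDiff_snd.comp_contDiffOn hy1).congr fun t ht => (hd t ht).deriv

lemma hasDerivAt_form_apply {E : Type*} [NormedAddCommGroup E] [NormedSpace ℝ E]
    {B : E → E →L[ℝ] E →L[ℝ] ℝ} {B' : E →L[ℝ] E →L[ℝ] E →L[ℝ] ℝ} {x v : ℝ → E} {x' v' : E} {t : ℝ}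
    (hB : HasFDerivAt B B' (x t)) (hx : HasDerivAt x x' t) (hv : HasDerivAt v v' t) :
    HasDerivAt (fun s => B (x s) (v s) (v s))
      (B' x' (v t) (v t) + B (x t) v' (v t) + B (x t) (v t) v') t :=
  ((hB.comp_hasDerivAt t hx).clm_apply hv).clm_apply hv

/-- Two curves with the same germ at `t₁` can be joined there. -/
lemma exists_glue {X : Type*} {γ η : ℝ → X} {t₁ : ℝ} (h : γ =ᶠ[𝓝 t₁] η) :
    ∃ ζ : ℝ → X, (∀ t ≤ t₁, γ =ᶠ[𝓝 t] ζ) ∧ ∀ t ≥ t₁, η =ᶠ[𝓝 t] ζ := by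
  classical
  refine ⟨fun s => if s < t₁ then γ s else η s, fun t ht => ?_, fun t ht => ?_⟩
  · rcases ht.lt_or_eq with ht | rfl
    · filter_upwards [gt_mem_nhds ht] with s hs
      rw [if_pos hs]
    · filter_upwards [h] with s hs
      split_ifs
      · rfl
      · exact hs
  · rcases ht.lt_or_eq with ht | rfl
    · filter_upwards [lt_mem_nhds ht] with s hs
      rw [if_neg hs.not_gt]
    · filter_upwards [h] with s hs
      split_ifs
      · exact hs.symm
      · rfl

section Length

variable {m : ℕ} {M : Type*} [MetricSpace M] [ChartedSpace (Model m) M]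
  [RiemannianBundle (fun x : M => TangentSpace (𝓡 m) x)] [IsRiemannianManifold (𝓡 m) M]

/-- The Riemannian distance is at most the length of the curve, which is the integral of the
constant speed. -/
lemma dist_le_of_speed_eq {γ : ℝ → M} {a b l : ℝ} (hab : a ≤ b)
    (hγ : ∀ t ∈ Icc a b, ContMDiffAt 𝓘(ℝ, ℝ) (𝓡 m) 1 γ t)
    (hl : ∀ t ∈ Icc a b, ‖(velocity m γ t).2‖ = l) : dist (γ b) (γ a) ≤ (b - a) * l := by
  have hl0 : 0 ≤ l := hl a ⟨le_rfl, hab⟩ ▸ norm_nonneg _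
  have h1 : edist (γ a) (γ b) ≤ ENNReal.ofReal ((b - a) * l) := by
    rw [IsRiemannianManifold.out (I := 𝓡 m) (γ a) (γ b)]
    refine (Manifold.riemannianEDist_le_pathELength (I := 𝓡 m) (γ := γ)
      (fun t ht => (hγ t ht).contMDiffWithinAt) rfl rfl hab).trans ?_
    rw [Manifold.pathELength_eq_lintegral_mfderiv_Icc]
    have : ∀ t ∈ Icc a b, ‖(mfderiv 𝓘(ℝ, ℝ) (𝓡 m) γ t (1 : ℝ) : TangentSpace (𝓡 m) (γ t))‖ₑ
        = ENNReal.ofReal l := fun t ht => by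
      rw [← ofReal_norm, ← hl t ht]
      rfl
    refine (MeasureTheory.setLIntegral_congr_fun measurableSet_Icc this).le.trans ?_
    simp only [MeasureTheory.lintegral_const, MeasurableSet.univ, MeasureTheory.Measure.restrict_apply,
      univ_inter, Real.volume_Icc]
    rw [← ENNReal.ofReal_mul hl0, mul_comm]
  rw [edist_dist] at h1
  rw [dist_comm]
  exact (ENNReal.ofReal_le_ofReal_iff (mul_nonneg (by linarith) hl0)).1 h1

end Length

/-! ### Local existence, constant speed, and geodesic completeness. -/

section Completeness

variable {m : ℕ} {M : Type*} [MetricSpace M] [ChartedSpace (Model m) M] [IsManifold (𝓡 m) ∞ M]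
  [RiemannianBundle (fun x : M => TangentSpace (𝓡 m) x)]
  [IsContMDiffRiemannianBundle (𝓡 m) ∞ (Model m) (fun x : M => TangentSpace (𝓡 m) x)]

/-- Existence of geodesics for a time that is locally uniform in the initial velocity; for short
times their velocities remain close to the initial one. -/
lemma exists_isGeodesicAt_uniform (c : M) {z₀ : Model m × Model m}
    (hz₀ : z₀.1 ∈ (extChartAt (𝓡 m) c).target) {W : Set (Model m × Model m)} (hW : W ∈ 𝓝 z₀) :
    ∃ ε > 0, ∀ᶠ z in 𝓝 z₀, ∀ t₀ : ℝ, ∃ γ : ℝ → M, velocity m γ t₀ = unphase c z ∧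
      ∀ t ∈ Ioo (t₀ - ε) (t₀ + ε), IsGeodesicAt m γ t ∧ γ t ∈ (extChartAt (𝓡 m) c).source ∧
        phase c (velocity m γ t) ∈ W := by
  obtain ⟨ε, hε, a, r, L, K, hr, hPL⟩ :=
    IsPicardLindelof.of_contDiffAt_one (phaseField_contDiffAt (c := c) hz₀)
  obtain ⟨α, hα, hαc⟩ := (hPL 0).exists_forall_mem_closedBall_eq_hasDerivWithinAt_continuousOn
  have hnhds : Metric.closedBall z₀ (r : ℝ) ×ˢ Icc (0 - ε) (0 + ε) ∈ 𝓝 (z₀, (0 : ℝ)) :=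
    prod_mem_nhds (Metric.closedBall_mem_nhds _ hr) (Icc_mem_nhds (by linarith) (by linarith))
  have hα0 : α (z₀, 0) = z₀ := (hα z₀ (Metric.mem_closedBall_self r.2)).1
  have hop : {z : Model m × Model m | z.1 ∈ (extChartAt (𝓡 m) c).target} ∩ W ∈
      𝓝 (α (z₀, 0)) := by
    rw [hα0]
    refine Filter.inter_mem ?_ hW
    exact ((isOpen_extChartAt_target c).preimage continuous_fst).mem_nhds hz₀
  have hev := ((hαc.continuousAt hnhds).eventually hop).and
    (prod_mem_nhds (Metric.closedBall_mem_nhds z₀ hr)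
      (Ioo_mem_nhds (show 0 - ε < (0 : ℝ) by linarith) (show (0 : ℝ) < 0 + ε by linarith)))
  -- Joint continuity of the flow in initial value and time, read on a product neighbourhood, makes
  -- the time `δ` independent of `z`.
  rw [nhds_prod_eq] at hev
  obtain ⟨U, hU, T, hT, hUT⟩ := Filter.eventually_prod_iff.1 hev
  obtain ⟨δ, hδ, hδT⟩ := Metric.eventually_nhds_iff_ball.1 hT
  refine ⟨δ, hδ, hU.mono fun z hz t₀ => ?_⟩
  set y : ℝ → Model m × Model m := fun s => α (z, s) with hy
  have hz0 := hUT hz (hδT 0 (Metric.mem_ball_self hδ))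
  have hy0 : y 0 = z := (hα z hz0.2.1).1
  have hJ : ∀ s ∈ Metric.ball (0 : ℝ) δ, (y s).1 ∈ (extChartAt (𝓡 m) c).target ∧
      HasDerivAt y ((y s).2, -spray c (y s).1 (y s).2) s ∧ y s ∈ W := by
    intro s hs
    have h1 := hUT hz (hδT s hs)
    exact ⟨h1.1.1, ((hα z hz0.2.1).2 s (Ioo_subset_Icc_self h1.2.2)).hasDerivAt
      (Icc_mem_nhds h1.2.2.1 h1.2.2.2), h1.1.2⟩
  have hC2 : ContDiffOn ℝ 2 (fun t => (y t).1) (Metric.ball 0 δ) :=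
    contDiffOn_fst_of_second_order (g := fun z => -spray c z.1 z.2) Metric.isOpen_ball
      (fun t ht => (hJ t ht).2.1) fun t ht => (phaseField_contDiffAt (hJ t ht).1).continuousAt.snd
  set γ : ℝ → M := fun s => (extChartAt (𝓡 m) c).symm (y s).1 with hγ
  have hcoord : ∀ s ∈ Metric.ball (0 : ℝ) δ, coord m c γ s = (y s).1 := fun s hs =>
    (extChartAt (𝓡 m) c).right_inv (hJ s hs).1
  have hcoord' : ∀ s ∈ Metric.ball (0 : ℝ) δ, coord m c γ =ᶠ[𝓝 s] fun s => (y s).1 := fun s hs =>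
    Filter.mem_of_superset (Metric.isOpen_ball.mem_nhds hs) hcoord
  have hd1 : ∀ s ∈ Metric.ball (0 : ℝ) δ, deriv (coord m c γ) s = (y s).2 := fun s hs =>
    (hcoord' s hs).deriv_eq.trans (HasDerivAt.deriv (f := fun t => (y t).1) (hJ s hs).2.1.fst)
  have hd2 : ∀ s ∈ Metric.ball (0 : ℝ) δ, deriv (deriv (coord m c γ)) s
      = -spray c (y s).1 (y s).2 := fun s hs => by
    have : deriv (coord m c γ) =ᶠ[𝓝 s] fun s => (y s).2 :=
      Filter.mem_of_superset (Metric.isOpen_ball.mem_nhds hs) hd1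
    exact this.deriv_eq.trans (HasDerivAt.deriv (f := fun t => (y t).2) (hJ s hs).2.1.snd)
  have hsrc : ∀ s ∈ Metric.ball (0 : ℝ) δ, γ s ∈ (extChartAt (𝓡 m) c).source := fun s hs =>
    (extChartAt (𝓡 m) c).map_target (hJ s hs).1
  have hgeo : ∀ s ∈ Metric.ball (0 : ℝ) δ, IsGeodesicAt m γ s := fun s hs => by
    refine isGeodesicAt_of_chart (c := c) ?_ (hsrc s hs) ?_
    · have h1 := (contMDiffOn_extChartAt_symm (I := 𝓡 m) (n := ∞) c).contMDiffAt
        ((isOpen_extChartAt_target c).mem_nhds (hJ s hs).1)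
      have h2 : ContMDiffAt 𝓘(ℝ, ℝ) 𝓘(ℝ, Model m) 2 (fun t => (y t).1) s :=
        contMDiffAt_iff_contDiffAt.2 (hC2.contDiffAt (Metric.isOpen_ball.mem_nhds hs))
      exact ContMDiffAt.comp s (h1.of_le (by norm_cast)) h2
    · rw [hd2 s hs, hcoord s hs, hd1 s hs]
  have h0 : (0 : ℝ) ∈ Metric.ball (0 : ℝ) δ := Metric.mem_ball_self hδ
  have hvel : velocity m γ 0 = unphase c z := by
    rw [← unphase_phase (P := velocity m γ 0) (hsrc 0 h0), (hgeo 0 h0).phase_velocity (hsrc 0 h0),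
      hcoord 0 h0, hd1 0 h0, hy0]
  -- The equation is autonomous, so a solution starting at time `0` is shifted to start at `t₀`.
  have hvel' : ∀ t, t + -t₀ ∈ Metric.ball (0 : ℝ) δ →
      velocity m (fun s => γ (1 * s + -t₀)) t = velocity m γ (t + -t₀) := fun t ht => by
    have e : 1 * t + -t₀ = t + -t₀ := by ring
    rw [velocity_comp_affine 1 (-t₀) (by rw [e]; exact hgeo _ ht), e, one_smul]
    rfl
  refine ⟨fun s => γ (1 * s + -t₀), ?_, fun t ht => ?_⟩
  · rw [hvel' t₀ (by rwa [add_neg_cancel]), add_neg_cancel, hvel]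
  · have ht' : t + -t₀ ∈ Metric.ball (0 : ℝ) δ := by
      rw [Metric.mem_ball, Real.dist_eq, abs_lt]
      constructor <;> linarith [ht.1, ht.2]
    refine ⟨IsGeodesicAt.comp_affine 1 (-t₀) (by rw [one_mul]; exact hgeo _ ht'),
      by simpa only [one_mul] using hsrc _ ht', ?_⟩
    rw [hvel' t ht', (hgeo _ ht').phase_velocity (hsrc _ ht'), hcoord _ ht', hd1 _ ht']
    exact (hJ _ ht').2.2

/-- Geodesics have constant speed. -/
lemma hasDerivAt_speed_sq {γ : ℝ → M} {t : ℝ} (h : ∀ᶠ s in 𝓝 t, IsGeodesicAt m γ s) :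
    HasDerivAt (fun s => ‖(velocity m γ s).2‖ ^ 2) 0 t := by
  set c := γ t
  have hc : γ t ∈ (extChartAt (𝓡 m) c).source := mem_extChartAt_source c
  have hcs : ∀ᶠ s in 𝓝 t, γ s ∈ (extChartAt (𝓡 m) c).source :=
    h.self_of_nhds.1.continuousAt.eventually (extChartAt_source_mem_nhds c)
  have heq : (fun s => ‖(velocity m γ s).2‖ ^ 2) =ᶠ[𝓝 t] fun s =>
      chartForm c (coord m c γ s) (deriv (coord m c γ) s) (deriv (coord m c γ) s) := by
    filter_upwards [h, hcs] with s h1 h2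
    have h3 := chartMetric_phase h2 (velocity m γ s).2 (velocity m γ s).2
    have h4 := h1.phase_velocity h2
    change phase c ⟨γ s, (velocity m γ s).2⟩ = _ at h4
    rw [h4] at h3
    exact ((real_inner_self_eq_norm_sq (F := TangentSpace (𝓡 m) (γ s)) _).symm.trans h3.symm)
  refine HasDerivAt.congr_of_eventuallyEq ?_ heq
  have hz := h.self_of_nhds.hasDerivAt_coord hc
  have hct := coord_mem_target hc
  have hx1 : HasDerivAt (coord m c γ) (deriv (coord m c γ) t) t := hz.fst
  have hx2 : HasDerivAt (deriv (coord m c γ))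
    (-spray c (coord m c γ t) (deriv (coord m c γ) t)) t := hz.snd
  have hB := ((chartForm_contDiffAt hct).differentiableAt (by simp)).hasFDerivAt
  refine (hasDerivAt_form_apply hB hx1 hx2).congr_deriv ?_
  -- With three equal arguments, `Γ(x', x'; x')` is half the derivative of the metric, so the two
  -- spray terms cancel that derivative.
  have e := chartMetric_spray hct (deriv (coord m c γ) t) (deriv (coord m c γ) t)
  have e' := e
  rw [chartMetric_comm, ← chartForm_apply] at e'
  rw [← chartForm_apply] at e
  simp only [christoffel, fderiv_chartMetric hct] at e e'
  rw [map_neg, map_neg, neg_apply, e, e']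
  ring

lemma speed_eq_of_isGeodesicAt {γ : ℝ → M} {s : Set ℝ} (ho : IsOpen s) (hs : IsPreconnected s)
    (hγ : ∀ t ∈ s, IsGeodesicAt m γ t) {t u : ℝ} (ht : t ∈ s) (hu : u ∈ s) :
    ‖(velocity m γ t).2‖ = ‖(velocity m γ u).2‖ := by
  have hd : ∀ t ∈ s, HasDerivAt (fun s => ‖(velocity m γ s).2‖ ^ 2) 0 t := fun t ht =>
    hasDerivAt_speed_sq (Filter.mem_of_superset (ho.mem_nhds ht) hγ)
  have := ho.is_const_of_deriv_eq_zero hs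
    (fun t ht => (hd t ht).differentiableAt.differentiableWithinAt) (fun t ht => (hd t ht).deriv)
    ht hu
  exact (pow_left_inj₀ (norm_nonneg _) (norm_nonneg _) two_ne_zero).1 this

variable [IsRiemannianManifold (𝓡 m) M]

lemma dist_le_of_isGeodesic {γ : ℝ → M} (hγ : IsGeodesic m γ) {s : ℝ} (hs : 0 ≤ s) :
    dist (γ s) (γ 0) ≤ s * ‖(velocity m γ 0).2‖ := by
  have h := isGeodesic_iff.1 hγ
  have := dist_le_of_speed_eq (m := m) hs (fun t _ => (h t).1.of_le (by norm_num)) (fun t _ =>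
    speed_eq_of_isGeodesicAt isOpen_univ isPreconnected_univ (fun t _ => h t) (mem_univ t)
      (mem_univ 0))
  simpa using this

end Completeness
section Completeness

variable {m : ℕ} {M : Type*} [MetricSpace M] [ChartedSpace (Model m) M] [IsManifold (𝓡 m) ∞ M]
  [RiemannianBundle (fun x : M => TangentSpace (𝓡 m) x)]
  [IsContMDiffRiemannianBundle (𝓡 m) ∞ (Model m) (fun x : M => TangentSpace (𝓡 m) x)]

/-- Coordinates of tangent vectors are bounded by their norm, locally uniformly. -/
lemma exists_norm_phase_le (c : M) : ∃ C > 0, ∀ᶠ q in 𝓝 c, ∀ v : TangentSpace (𝓡 m) q,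
    ‖(phase c ⟨q, v⟩).2‖ ≤ C * ‖v‖ := by
  have : IsContinuousRiemannianBundle (Model m) (fun x : M => TangentSpace (𝓡 m) x) := by
    obtain ⟨g, hg, h⟩ := IsContMDiffRiemannianBundle.exists_contMDiff (IB := 𝓡 m) (n := ∞)
      (F := Model m) (E := fun x : M => TangentSpace (𝓡 m) x)
    exact ⟨g, hg.continuous, h⟩
  obtain ⟨C, hC, h⟩ := eventually_norm_trivializationAt_lt (Model m)
    (fun x : M => TangentSpace (𝓡 m) x) c
  refine ⟨C, hC, ?_⟩
  filter_upwards [h, chart_source_mem_nhds (Model m) c] with q hq hq' v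
  have e := TangentBundle.continuousLinearMapAt_trivializationAt (I := 𝓡 m) hq'
  refine (le_of_eq ?_).trans (((Trivialization.continuousLinearMapAt ℝ
    (trivializationAt (Model m) (TangentSpace (𝓡 m)) c) q).le_opNorm v).trans
    (mul_le_mul_of_nonneg_right hq.le (norm_nonneg _)))
  rw [e]
  rfl

variable [IsRiemannianManifold (𝓡 m) M] [CompleteSpace M]

/-- In a complete Riemannian manifold, a geodesic on a bounded interval can be continued beyond
the right endpoint. -/
lemma exists_isGeodesicAt_extension {γ : ℝ → M} {a b t₀ : ℝ} (ht₀ : t₀ ∈ Ioo a b)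
    (hγ : ∀ t ∈ Ioo a b, IsGeodesicAt m γ t) :
    ∃ ε > 0, ∃ η : ℝ → M, velocity m η t₀ = velocity m γ t₀ ∧
      ∀ t ∈ Ioo a (b + ε), IsGeodesicAt m η t := by
  obtain ⟨l, hl⟩ : ∃ l, ∀ t ∈ Ioo a b, ‖(velocity m γ t).2‖ = l :=
    ⟨_, fun t ht => speed_eq_of_isGeodesicAt isOpen_Ioo isPreconnected_Ioo hγ ht ht₀⟩
  have hl0 : 0 ≤ l := hl t₀ ht₀ ▸ norm_nonneg _
  obtain ⟨u, hu1, hu2, hu3⟩ := exists_seq_strictMono_tendsto' ht₀.2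
  have hu : ∀ k, u k ∈ Ioo a b := fun k => ⟨ht₀.1.trans (hu2 k).1, (hu2 k).2⟩
  have hdist : ∀ {s t}, s ∈ Ioo a b → t ∈ Ioo a b → s ≤ t → dist (γ t) (γ s) ≤ (t - s) * l := by
    intro s t hs ht hst
    have hsub : Icc s t ⊆ Ioo a b := fun r hr => ⟨hs.1.trans_le hr.1, hr.2.trans_lt ht.2⟩
    exact dist_le_of_speed_eq hst (fun r hr => (hγ r (hsub hr)).1.of_le (by norm_num))
      fun r hr => hl r (hsub hr)
  -- Constant speed makes the curve Lipschitz, so it has a limit point `q` at time `b`, around which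
  -- a chart is available.
  have hcauchy : CauchySeq fun k => γ (u k) := by
    refine cauchySeq_of_le_tendsto_0 (fun k => (b - u k) * l) (fun i j N hi hj => ?_) ?_
    · wlog hij : i ≤ j generalizing i j
      · rw [dist_comm]; exact this j i hj hi (le_of_not_ge hij)
      rw [dist_comm]
      refine (hdist (hu i) (hu j) (hu1.monotone hij)).trans
        (mul_le_mul_of_nonneg_right ?_ hl0)
      linarith [hu1.monotone hi, (hu j).2]
    · simpa using ((tendsto_const_nhds (x := b)).sub hu3).mul_const l
  obtain ⟨q, hq⟩ := cauchySeq_tendsto_of_complete hcauchy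
  obtain ⟨C, hC, hCev⟩ := exists_norm_phase_le (m := m) q
  have hsrc : ∀ᶠ k in atTop, γ (u k) ∈ (extChartAt (𝓡 m) q).source :=
    hq.eventually (extChartAt_source_mem_nhds q)
  have hbdd : ∀ᶠ k in atTop, (phase q (velocity m γ (u k))).2 ∈
      Metric.closedBall (0 : Model m) (C * l) := by
    filter_upwards [hq.eventually hCev] with k hk
    rw [mem_closedBall_zero_iff, ← hl _ (hu k)]
    exact hk _
  obtain ⟨w, -, φ, hφ, hw⟩ := tendsto_subseq_of_frequently_bounded Metric.isBounded_closedBall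
    hbdd.frequently
  have hx : Tendsto (fun k => (phase q (velocity m γ (u k))).1) atTop
      (𝓝 (extChartAt (𝓡 m) q q)) := (continuousAt_extChartAt q).tendsto.comp hq
  have hz : Tendsto (fun k => phase q (velocity m γ (u (φ k)))) atTop
      (𝓝 (extChartAt (𝓡 m) q q, w)) := (hx.comp hφ.tendsto_atTop).prodMk_nhds hw
  obtain ⟨ε, hε, hev⟩ := exists_isGeodesicAt_uniform (m := m) q
    (z₀ := (extChartAt (𝓡 m) q q, w)) (mem_extChartAt_target q) univ_mem
  -- The existence time `ε` is common to all initial data near `(q, w)`. Restarting later than `b -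
  -- ε / 2` therefore leads past `b + ε / 2`.
  have hub : ∀ᶠ k in atTop, b - ε / 2 < u (φ k) :=
    (hu3.comp hφ.tendsto_atTop).eventually (lt_mem_nhds (by linarith))
  obtain ⟨k, hk1, hk2, hk3⟩ := ((hz.eventually hev).and
    ((hφ.tendsto_atTop.eventually hsrc).and hub)).exists
  obtain ⟨η, hη1, hη2⟩ := hk1 (u (φ k))
  rw [unphase_phase hk2] at hη1
  have hk := hu (φ k)
  obtain ⟨ζ, hζ1, hζ2⟩ := exists_glue (eventuallyEq_of_isGeodesicAt
    (Filter.mem_of_superset (isOpen_Ioo.mem_nhds hk) hγ)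
    (Filter.mem_of_superset (isOpen_Ioo.mem_nhds
      (show u (φ k) ∈ Ioo (u (φ k) - ε) (u (φ k) + ε) from ⟨by linarith, by linarith⟩))
      fun t ht => (hη2 t ht).1)
    hη1.symm)
  refine ⟨ε / 2, by linarith, ζ, (velocity_congr (hζ1 t₀ (hu2 _).1.le)).symm, fun t ht => ?_⟩
  rcases le_total t (u (φ k)) with h | h
  · exact (hγ t ⟨ht.1, h.trans_lt hk.2⟩).congr (hζ1 t h)
  · exact (hη2 t ⟨by linarith, by linarith [ht.2]⟩).1.congr (hζ2 t h)

/-- In a complete Riemannian manifold geodesics exist for all positive times. -/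
lemma exists_isGeodesicAt_forward (P : TangentBundle (𝓡 m) M) :
    ∃ ε > 0, ∃ γ : ℝ → M, velocity m γ 0 = P ∧ ∀ t > -ε, IsGeodesicAt m γ t := by
  classical
  obtain ⟨ε, hε, hev⟩ := exists_isGeodesicAt_uniform (m := m) P.1 (z₀ := phase P.1 P)
    (mem_extChartAt_target P.1) univ_mem
  obtain ⟨γ₀, h₀, h₀'⟩ := hev.self_of_nhds 0
  rw [unphase_phase (mem_extChartAt_source P.1)] at h₀
  refine ⟨ε, hε, ?_⟩
  -- Right endpoints of solutions. By uniqueness the solutions fit together, and a finite supremum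
  -- would contradict the extension lemma. The left end `-ε` keeps `0` interior.
  set S : Set ℝ := {b | 0 < b ∧ ∃ γ : ℝ → M, velocity m γ 0 = P ∧
    ∀ t ∈ Ioo (-ε) b, IsGeodesicAt m γ t} with hS
  have hεS : ε ∈ S := ⟨hε, γ₀, h₀, fun t ht => (h₀' t ⟨by linarith [ht.1], by linarith [ht.2]⟩).1⟩
  have : Nonempty M := ⟨P.1⟩
  choose! Γ hΓ0 hΓ using fun b (hb : b ∈ S) => hb.2
  have hagree : ∀ b ∈ S, ∀ b' ∈ S, ∀ t ∈ Ioo (-ε) (min b b'), Γ b t = Γ b' t := by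
    intro b hb b' hb'
    refine eqOn_of_isGeodesicAt (m := m) isOpen_Ioo isPreconnected_Ioo
      (fun t ht => hΓ b hb t ⟨ht.1, ht.2.trans_le (min_le_left _ _)⟩)
      (fun t ht => hΓ b' hb' t ⟨ht.1, ht.2.trans_le (min_le_right _ _)⟩)
      (t₀ := 0) ⟨by linarith, lt_min hb.1 hb'.1⟩ ((hΓ0 b hb).trans (hΓ0 b' hb').symm)
  -- `P.1` is a filler for times beyond every `b ∈ S`.
  set γ : ℝ → M := fun t => if h : ∃ b ∈ S, t < b then Γ h.choose t else P.1 with hγdef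
  have hγ : ∀ b ∈ S, ∀ t ∈ Ioo (-ε) b, Γ b =ᶠ[𝓝 t] γ := by
    intro b hb t ht
    filter_upwards [isOpen_Ioo.mem_nhds ht] with s hs
    have h : ∃ b ∈ S, s < b := ⟨b, hb, hs.2⟩
    simp only [hγdef, dif_pos h]
    exact hagree b hb _ h.choose_spec.1 s ⟨hs.1, lt_min hs.2 h.choose_spec.2⟩
  have hv : velocity m γ 0 = P :=
    (velocity_congr (hγ ε hεS 0 ⟨by linarith, hε⟩)).symm.trans (hΓ0 ε hεS)
  have hgeo : ∀ b ∈ S, ∀ t ∈ Ioo (-ε) b, IsGeodesicAt m γ t := fun b hb t ht =>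
    (hΓ b hb t ht).congr (hγ b hb t ht)
  by_cases hbdd : BddAbove S
  · exfalso
    have hpos : 0 < sSup S := hε.trans_le (le_csSup hbdd hεS)
    obtain ⟨δ, hδ, η, hη0, hη⟩ := exists_isGeodesicAt_extension (m := m) (γ := γ) (a := -ε)
      (b := sSup S) (t₀ := 0) ⟨by linarith, hpos⟩ (fun t ht => by
        obtain ⟨b, hb, htb⟩ := exists_lt_of_lt_csSup ⟨ε, hεS⟩ ht.2
        exact hgeo b hb t ⟨ht.1, htb⟩)
    have : sSup S + δ ∈ S := ⟨by linarith, η, hη0.trans hv, hη⟩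
    linarith [le_csSup hbdd this]
  · refine ⟨γ, hv, fun t ht => ?_⟩
    obtain ⟨b, hb, htb⟩ := not_bddAbove_iff.1 hbdd t
    exact hgeo b hb t ⟨ht, htb⟩

/-- Complete Riemannian manifolds are geodesically complete. -/
theorem exists_isGeodesic (P : TangentBundle (𝓡 m) M) :
    ∃ γ : ℝ → M, IsGeodesic m γ ∧ velocity m γ 0 = P := by
  obtain ⟨ε, hε, γ, hγ0, hγ⟩ := exists_isGeodesicAt_forward P
  obtain ⟨δ, hδ, η, hη0, hη⟩ := exists_isGeodesicAt_forward (⟨P.1, -P.2⟩ : TangentBundle (𝓡 m) M)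
  -- The past is the time reversal of the forward geodesic with opposite velocity. Both halves exist
  -- around `0`, so their germs there coincide and they can be glued.
  have hη' : ∀ t < δ, IsGeodesicAt m (fun s => η (-1 * s + 0)) t := fun t ht =>
    (hη _ (by linarith)).comp_affine
  have hv : velocity m (fun s => η (-1 * s + 0)) 0 = P := by
    have e : -1 * (0 : ℝ) + 0 = 0 := by ring
    rw [velocity_comp_affine (-1) 0 (hη _ (by linarith)), e]
    have key : ∀ Q : TangentBundle (𝓡 m) M, Q = ⟨P.1, -P.2⟩ →
        (⟨Q.1, (-1 : ℝ) • Q.2⟩ : TangentBundle (𝓡 m) M) = P := by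
      rintro _ rfl
      simp
    exact key _ hη0
  obtain ⟨ζ, hζ1, hζ2⟩ := exists_glue (eventuallyEq_of_isGeodesicAt
    ((gt_mem_nhds hδ).mono hη') ((lt_mem_nhds (neg_lt_zero.2 hε)).mono hγ) (hv.trans hγ0.symm))
  refine ⟨ζ, isGeodesic_iff.2 fun t => ?_, (velocity_congr (hζ2 0 le_rfl)).symm.trans hγ0⟩
  rcases le_total t 0 with h | h
  · exact (hη' t (by linarith)).congr (hζ1 t h)
  · exact (hγ t (by linarith)).congr (hζ2 t h)

end Completeness
-- Descent directions and the function `alpha`.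
section Directions

variable {m n : ℕ} {M : Type*} [MetricSpace M] [ChartedSpace (Model m) M]

lemma jacobian_smul (F : M → Fin n → ℝ) (p : M) (r : ℝ) (v : TangentSpace (𝓡 m) p) (i : Fin n) :
    jacobian F p (r • v) i = r * jacobian F p v i :=
  ContinuousLinearMap.map_smul (mfderiv (𝓡 m) 𝓘(ℝ, ℝ) (fun q => F q i) p) r v

lemma jacobian_le_iSup (F : M → Fin n → ℝ) (p : M) (v : TangentSpace (𝓡 m) p) (i : Fin n) :
    jacobian F p v i ≤ ⨆ j, jacobian F p v j :=
  le_ciSup (Set.finite_range _).bddAbove i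

/-- The chain rule along a curve. -/
lemma hasDerivAt_comp_curve {F : M → Fin n → ℝ}
    (hF : ∀ i, ContMDiff (𝓡 m) 𝓘(ℝ, ℝ) 1 (fun p => F p i)) {γ : ℝ → M} {t : ℝ}
    (hγ : MDifferentiableAt 𝓘(ℝ, ℝ) (𝓡 m) γ t) (i : Fin n) :
    HasDerivAt (fun s => F (γ s) i)
      (jacobian F (velocity m γ t).1 (velocity m γ t).2 i) t := by
  have h1 := ((hF i).mdifferentiable (by simp) (γ t)).hasMFDerivAt
  let L : ℝ →L[ℝ] ℝ := (mfderiv (𝓡 m) 𝓘(ℝ, ℝ) (fun p => F p i) (γ t)).comp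
    (mfderiv 𝓘(ℝ, ℝ) (𝓡 m) γ t)
  have h2 : HasFDerivAt (fun s => F (γ s) i) L t :=
    (HasMFDerivAt.comp t h1 hγ.hasMFDerivAt).hasFDerivAt
  exact h2.hasDerivAt

variable [RiemannianBundle (fun x : M => TangentSpace (𝓡 m) x)]

/-- The minimizer is replaced by an arbitrary competitor `w`, so that later estimates only need a
convenient `w`. -/
lemma jacobian_le_of_mem_approxSteepest {F : M → Fin n → ℝ} {σ : ℝ} (hσ : σ ∈ Ioo (0 : ℝ) 1) {p : M}
    {v : TangentSpace (𝓡 m) p} (hv : v ∈ approxSteepest m F σ p) (w : TangentSpace (𝓡 m) p)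
    (i : Fin n) : jacobian F p v i ≤ (1 - σ) * alpha F p w - ‖v‖ ^ 2 / 2 := by
  obtain ⟨u, hu, huv⟩ := hv
  have h1 : alpha F p u ≤ alpha F p w := hu (mem_univ w)
  have h2 := jacobian_le_iSup F p v i
  simp only [alpha] at huv h1 ⊢
  nlinarith [hσ.2]

/-- The step-size inequality holds for all small steps in a descent direction. -/
lemma exists_sufficientDecrease {F : M → Fin n → ℝ}
    (hF : ∀ i, ContMDiff (𝓡 m) 𝓘(ℝ, ℝ) 1 (fun p => F p i)) {β : ℝ} (hβ : β ∈ Ioo (0 : ℝ) 1) {p : M}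
    {v : TangentSpace (𝓡 m) p} (hv : ∀ i, jacobian F p v i < 0) {γ : ℝ → M}
    (hγ : IsGeodesic m γ) (h0 : velocity m γ 0 = ⟨p, v⟩) :
    ∃ t ∈ Ioc (0 : ℝ) 1, SufficientDecrease F β p v γ t := by
  have hp : γ 0 = p := congrArg TotalSpace.proj h0
  have hev : ∀ i, ∀ᶠ t in 𝓝[>] (0 : ℝ), F (γ t) i ≤ F p i + β * t * jacobian F p v i := by
    intro i
    have hd := hasDerivAt_comp_curve hF (hγ.1.mdifferentiable (by simp) 0) i
    rw [h0] at hd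
    have hs := (hasDerivAt_iff_tendsto_slope.1 hd).mono_left
      (nhdsWithin_mono 0 (fun t (ht : 0 < t) => ht.ne'))
    -- The derivative is negative and `β < 1`, so the difference quotient is eventually below this
    -- larger slope.
    have hlt : jacobian F p v i < β * jacobian F p v i := by nlinarith [hv i, hβ.2]
    filter_upwards [hs.eventually (gt_mem_nhds hlt), self_mem_nhdsWithin] with t ht ht0
    rw [slope_def_field, sub_zero, div_lt_iff₀ ht0, hp] at ht
    linarith
  obtain ⟨t, ht1, ht2⟩ := ((eventually_all.2 hev).and (Ioc_mem_nhdsGT zero_lt_one)).exists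
  exact ⟨t, ht2, fun i => ht1 i⟩

variable [NeZero n]

lemma continuous_alpha (F : M → Fin n → ℝ) (p : M) : Continuous (alpha (m := m) F p) := by
  have h : Continuous fun v : TangentSpace (𝓡 m) p => ⨆ i, jacobian F p v i := by
    simp only [← Finset.sup'_univ_eq_ciSup]
    refine Continuous.finset_sup'_apply _ fun i _ => ?_
    exact (mfderiv (𝓡 m) 𝓘(ℝ, ℝ) (fun q => F q i) p).continuous
  exact h.add ((continuous_norm.pow 2).div_const 2)

lemma alpha_zero (F : M → Fin n → ℝ) (p : M) : alpha (m := m) F p 0 = 0 := by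
  have h (i : Fin n) : jacobian F p (0 : TangentSpace (𝓡 m) p) i = 0 :=
    ContinuousLinearMap.map_zero (mfderiv (𝓡 m) 𝓘(ℝ, ℝ) (fun q => F q i) p)
  simp [alpha, h]

/-- Coercivity: one component bounds the maximum below by `-‖A‖ ‖v‖`, so `alpha` is at least `0 =
alpha 0` once `‖v‖ ≥ 2‖A‖`. -/
lemma exists_isMinOn_alpha (F : M → Fin n → ℝ) (p : M) :
    ∃ u : TangentSpace (𝓡 m) p, IsMinOn (alpha (m := m) F p) univ u := by
  have : FiniteDimensional ℝ (TangentSpace (𝓡 m) p) :=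
    inferInstanceAs (FiniteDimensional ℝ (Model m))
  have : ProperSpace (TangentSpace (𝓡 m) p) := FiniteDimensional.proper_real _
  set A : TangentSpace (𝓡 m) p →L[ℝ] ℝ := mfderiv (𝓡 m) 𝓘(ℝ, ℝ) (fun q => F q 0) p with hA
  have hlow : ∀ v : TangentSpace (𝓡 m) p, -(‖A‖ * ‖v‖) + ‖v‖ ^ 2 / 2 ≤ alpha F p v := by
    intro v
    have h1 : -(‖A‖ * ‖v‖) ≤ A v := (abs_le.1 (A.le_opNorm v)).1
    have h2 : A v ≤ ⨆ i, jacobian F p v i := jacobian_le_iSup F p v 0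
    simp only [alpha]
    linarith
  obtain ⟨u, hu⟩ := (continuous_alpha (m := m) F p).exists_forall_le' 0 (by
    have h := tendsto_norm_cocompact_atTop (E := TangentSpace (𝓡 m) p)
    filter_upwards [h.eventually_ge_atTop (2 * ‖A‖ + 1)] with v hv
    rw [alpha_zero]
    refine le_trans ?_ (hlow v)
    nlinarith [norm_nonneg A, norm_nonneg v])
  exact ⟨u, fun v _ => hu v⟩

lemma exists_alpha_neg {F : M → Fin n → ℝ} {p : M} (hp : ¬ IsParetoCritical m F p) :
    ∃ w : TangentSpace (𝓡 m) p, alpha F p w < 0 := by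
  obtain ⟨w, hw⟩ := not_not.1 hp
  set μ := ⨆ i, jacobian F p w i with hμ
  have hμ0 : μ < 0 := by
    obtain ⟨i, hi⟩ := exists_eq_ciSup_of_finite (f := fun i => jacobian F p w i)
    rw [hμ, ← hi]
    exact hw i
  -- With this `r`, the linear bound `r * μ` equals `-r²(‖w‖² + 1)` and outweighs `r²‖w‖²/2`, even
  -- when `w = 0` is not excluded.
  set r : ℝ := -μ / (‖w‖ ^ 2 + 1) with hr
  have hr0 : 0 < r := div_pos (neg_pos.2 hμ0) (by positivity)
  have hr1 : r * (‖w‖ ^ 2 + 1) = -μ := div_mul_cancel₀ _ (by positivity)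
  refine ⟨r • w, ?_⟩
  have h1 : (⨆ i, jacobian F p (r • w) i) ≤ r * μ := ciSup_le fun i => by
    rw [jacobian_smul]
    exact mul_le_mul_of_nonneg_left (jacobian_le_iSup F p w i) hr0.le
  have h2 : ‖r • w‖ ^ 2 = r ^ 2 * ‖w‖ ^ 2 := by
    rw [norm_smul, mul_pow, Real.norm_eq_abs, sq_abs]
  simp only [alpha]
  rw [h2]
  nlinarith [mul_pos hr0 hr0]

/-- The exact minimizer qualifies: its value is nonpositive, so multiplying by `1 - σ` can only
raise it. -/
lemma approxSteepest_nonempty (F : M → Fin n → ℝ) {σ : ℝ} (hσ : σ ∈ Ioo (0 : ℝ) 1) (p : M) :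
    (approxSteepest m F σ p).Nonempty := by
  obtain ⟨u, hu⟩ := exists_isMinOn_alpha (m := m) F p
  have h0 : alpha F p u ≤ 0 := by
    rw [← alpha_zero (m := m) F p]
    exact hu (mem_univ _)
  exact ⟨u, u, hu, by nlinarith [hσ.1]⟩

lemma jacobian_neg_of_mem_approxSteepest {F : M → Fin n → ℝ} {σ : ℝ} (hσ : σ ∈ Ioo (0 : ℝ) 1)
    {p : M} (hp : ¬ IsParetoCritical m F p) {v : TangentSpace (𝓡 m) p}
    (hv : v ∈ approxSteepest m F σ p) (i : Fin n) : jacobian F p v i < 0 := by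
  obtain ⟨w, hw⟩ := exists_alpha_neg (m := m) hp
  have := jacobian_le_of_mem_approxSteepest hσ hv w i
  nlinarith [hσ.2, sq_nonneg ‖v‖]

lemma jacobian_le_neg_norm_sq {F : M → Fin n → ℝ} {σ : ℝ} (hσ : σ ∈ Ioo (0 : ℝ) 1)
    {p : M} {v : TangentSpace (𝓡 m) p} (hv : v ∈ approxSteepest m F σ p) (i : Fin n) :
    jacobian F p v i ≤ -(‖v‖ ^ 2 / 2) := by
  have := jacobian_le_of_mem_approxSteepest hσ hv 0 i
  rw [alpha_zero] at this
  linarith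

end Directions
-- Continuity of the Jacobian and of `alpha` in a chart.
section ChartDerivative

variable {m n : ℕ} {M : Type*} [MetricSpace M] [ChartedSpace (Model m) M]

/-- The derivative of `f` in the chart at `c`. -/
noncomputable def chartDeriv (f : M → ℝ) (c : M) (x : Model m) : Model m →L[ℝ] ℝ :=
  fderiv ℝ (fun y => f ((extChartAt (𝓡 m) c).symm y)) x

variable [IsManifold (𝓡 m) ∞ M]

lemma chartDeriv_continuousAt {f : M → ℝ} (hf : ContMDiff (𝓡 m) 𝓘(ℝ, ℝ) 1 f) {c : M} {x : Model m}
    (hx : x ∈ (extChartAt (𝓡 m) c).target) : ContinuousAt (chartDeriv f c) x := by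
  have h1 := (contMDiffOn_extChartAt_symm (I := 𝓡 m) (n := ∞) c).contMDiffAt
    ((isOpen_extChartAt_target c).mem_nhds hx)
  have h2 : ContDiffAt ℝ 1 (fun y => f ((extChartAt (𝓡 m) c).symm y)) x :=
    contMDiffAt_iff_contDiffAt.1 (ContMDiffAt.comp x hf.contMDiffAt (h1.of_le (by norm_cast)))
  exact h2.continuousAt_fderiv (by simp)

lemma jacobian_eq_chartDeriv {F : M → Fin n → ℝ}
    (hF : ∀ i, ContMDiff (𝓡 m) 𝓘(ℝ, ℝ) 1 (fun p => F p i)) {c : M} {P : TangentBundle (𝓡 m) M}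
    (hP : P.1 ∈ (extChartAt (𝓡 m) c).source) (i : Fin n) :
    jacobian F P.1 P.2 i = chartDeriv (fun p => F p i) c (phase c P).1 (phase c P).2 := by
  have h0 := unphase_phase hP
  have hx : (phase c P).1 ∈ (extChartAt (𝓡 m) c).target := (extChartAt (𝓡 m) c).map_source hP
  generalize phase c P = z at h0 hx
  subst h0
  have h1 := mfderiv_comp z.1 ((hF i).mdifferentiable (by simp) _)
    (mdifferentiableAt_extChartAt_symm hx)
  rw [chartDeriv, ← mfderiv_eq_fderiv]
  exact (congrArg (fun L => L z.2) h1).symm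

variable [RiemannianBundle (fun x : M => TangentSpace (𝓡 m) x)]

lemma alpha_eq_chart {F : M → Fin n → ℝ}
    (hF : ∀ i, ContMDiff (𝓡 m) 𝓘(ℝ, ℝ) 1 (fun p => F p i)) {c : M} {P : TangentBundle (𝓡 m) M}
    (hP : P.1 ∈ (extChartAt (𝓡 m) c).source) :
    alpha F P.1 P.2 = (⨆ i, chartDeriv (fun p => F p i) c (phase c P).1 (phase c P).2)
      + chartForm c (phase c P).1 (phase c P).2 (phase c P).2 / 2 := by
  have h : chartForm c (phase c P).1 (phase c P).2 (phase c P).2 = ‖P.2‖ ^ 2 :=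
    (chartMetric_phase hP P.2 P.2).trans (real_inner_self_eq_norm_sq P.2)
  rw [h, alpha]
  simp only [jacobian_eq_chartDeriv hF hP]

variable [NeZero n] [IsContMDiffRiemannianBundle (𝓡 m) ∞ (Model m) (fun x : M => TangentSpace (𝓡 m) x)]

/-- The optimal value of `alpha` is bounded away from zero near a noncritical point. -/
lemma exists_alpha_le_near {F : M → Fin n → ℝ}
    (hF : ∀ i, ContMDiff (𝓡 m) 𝓘(ℝ, ℝ) 1 (fun p => F p i)) {q : M}
    (hq : ¬ IsParetoCritical m F q) :
    ∃ a > 0, ∀ᶠ p in 𝓝 q, ∃ w : TangentSpace (𝓡 m) p, alpha F p w ≤ -a := by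
  obtain ⟨w, hw⟩ := exists_alpha_neg (m := m) hq
  set P : TangentBundle (𝓡 m) M := ⟨q, w⟩ with hPdef
  have hsrc : P.1 ∈ (extChartAt (𝓡 m) q).source := mem_extChartAt_source q
  have hqt : extChartAt (𝓡 m) q q ∈ (extChartAt (𝓡 m) q).target := mem_extChartAt_target q
  -- The coordinates `b` of the competitor are kept fixed while the base point varies; continuity
  -- keeps `alpha` below half its negative value at `q`.
  set b := (phase q P).2 with hb
  have hcont : ContinuousAt (fun x : Model m => (⨆ i, chartDeriv (fun p => F p i) q x b)
      + chartForm q x b b / 2) (extChartAt (𝓡 m) q q) := by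
    have h1 : ContinuousAt (fun x : Model m => ⨆ i, chartDeriv (fun p => F p i) q x b)
        (extChartAt (𝓡 m) q q) := by
      simp only [← Finset.sup'_univ_eq_ciSup]
      exact ContinuousAt.finset_sup'_apply _ fun i _ =>
        (chartDeriv_continuousAt (hF i) hqt).clm_apply continuousAt_const
    have h2 : ContinuousAt (fun x : Model m => chartForm q x b b) (extChartAt (𝓡 m) q q) :=
      ((chartForm_contDiffAt hqt).continuousAt.clm_apply continuousAt_const).clm_apply
        continuousAt_const
    exact h1.add (h2.div_const 2)
  have hval := alpha_eq_chart hF hsrc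
  have hneg : (⨆ i, chartDeriv (fun p => F p i) q (extChartAt (𝓡 m) q q) b)
      + chartForm q (extChartAt (𝓡 m) q q) b b / 2 < alpha F q w / 2 := by
    refine hval.symm.trans_lt ?_
    change alpha F q w < alpha F q w / 2
    linarith
  refine ⟨-(alpha F q w / 2), by linarith, ?_⟩
  have hev := (continuousAt_extChartAt (I := 𝓡 m) q).eventually
    (hcont.eventually (gt_mem_nhds hneg))
  filter_upwards [hev, extChartAt_source_mem_nhds (I := 𝓡 m) q] with p hp hps
  have hpt : extChartAt (𝓡 m) q p ∈ (extChartAt (𝓡 m) q).target :=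
    (extChartAt (𝓡 m) q).map_source hps
  set Q : TangentBundle (𝓡 m) M := unphase q (extChartAt (𝓡 m) q p, b) with hQ
  have hQ1 : Q.1 = p := (extChartAt (𝓡 m) q).left_inv hps
  have hQp : phase q Q = (extChartAt (𝓡 m) q p, b) := phase_unphase hpt
  have hQv := alpha_eq_chart hF (c := q) (P := Q) (by rw [hQ1]; exact hps)
  rw [hQp] at hQv
  rw [← hQ1]
  exact ⟨Q.2, by rw [hQv, neg_neg]; exact hp.le⟩

end ChartDerivative
-- Summability and criticality of cluster points.
section Algorithm

variable {m n : ℕ} {M : Type*} [MetricSpace M] [ChartedSpace (Model m) M]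
  [RiemannianBundle (fun x : M => TangentSpace (𝓡 m) x)]

/-- The step-size inequality holds if it holds for the derivatives along the geodesic. -/
lemma sufficientDecrease_of_jacobian_le {F : M → Fin n → ℝ}
    (hF : ∀ i, ContMDiff (𝓡 m) 𝓘(ℝ, ℝ) 1 (fun p => F p i)) {γ : ℝ → M} (hγ : IsGeodesic m γ)
    {p : M} {v : TangentSpace (𝓡 m) p} (h0 : velocity m γ 0 = ⟨p, v⟩) {β τ : ℝ} (hτ : 0 ≤ τ)
    (h : ∀ i, ∀ s ∈ Ioo 0 τ, jacobian F (velocity m γ s).1 (velocity m γ s).2 i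
      ≤ β * jacobian F p v i) : SufficientDecrease F β p v γ τ := by
  intro i
  have hp : γ 0 = p := congrArg TotalSpace.proj h0
  have hd := fun t => hasDerivAt_comp_curve hF (hγ.1.mdifferentiable (by simp) t) i
  have := Convex.image_sub_le_mul_sub_of_deriv_le (convex_Icc 0 τ) (f := fun s => F (γ s) i)
    (fun t _ => (hd t).continuousAt.continuousWithinAt)
    (fun t _ => (hd t).differentiableAt.differentiableWithinAt)
    (C := β * jacobian F p v i) (fun t ht => by
      rw [interior_Icc] at ht
      rw [(hd t).deriv]
      exact h i t ht) 0 ⟨le_rfl, hτ⟩ τ ⟨hτ, le_rfl⟩ hτ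
  rw [hp] at this
  change F (γ τ) i ≤ F p i + β * τ * jacobian F p v i
  linarith

lemma IsGenerated.decrease_apply {F : M → Fin n → ℝ} {σ β R : ℝ} {N : ℕ∞}
    {p : ℕ → M} {v : ∀ k, TangentSpace (𝓡 m) (p k)} {t : ℕ → ℝ} {γ : ℕ → ℝ → M}
    (h : IsGenerated F σ β R N p v t γ) {k : ℕ} (hk : (k : ℕ∞) < N) (i : Fin n) :
    F (p (k + 1)) i ≤ F (p k) i + β * t k * jacobian F (p k) (v k) i := by
  rw [h.next k hk]
  exact h.decrease k hk i

variable [NeZero n]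

lemma IsGenerated.jacobian_neg {F : M → Fin n → ℝ} {σ β R : ℝ} (hσ : σ ∈ Ioo (0 : ℝ) 1) {N : ℕ∞}
    {p : ℕ → M} {v : ∀ k, TangentSpace (𝓡 m) (p k)} {t : ℕ → ℝ} {γ : ℕ → ℝ → M}
    (h : IsGenerated F σ β R N p v t γ) {k : ℕ} (hk : (k : ℕ∞) < N) (i : Fin n) :
    jacobian F (p k) (v k) i < 0 :=
  jacobian_neg_of_mem_approxSteepest hσ (h.not_critical k hk) (h.direction k hk) i

/-- The sum of the squared lengths of the steps is finite. -/
lemma IsGenerated.summable {F : M → Fin n → ℝ} {σ β R : ℝ} (hσ : σ ∈ Ioo (0 : ℝ) 1)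
    (hβ : β ∈ Ioo (0 : ℝ) 1) {N : ℕ∞}
    {p : ℕ → M} {v : ∀ k, TangentSpace (𝓡 m) (p k)} {t : ℕ → ℝ} {γ : ℕ → ℝ → M}
    (h : IsGenerated F σ β R N p v t γ) (hφ : MeritIsReal F) :
    Summable fun k : {k : ℕ // (k : ℕ∞) < N} => t k ^ 2 * ‖v k‖ ^ 2 := by
  obtain ⟨C, hC⟩ := hφ (p 0)
  have hC' : ∀ q, (⨅ i, (F (p 0) i - F q i)) ≤ C := fun q => hC ⟨q, rfl⟩
  have hR : ∀ k : ℕ, (k : ℕ∞) < N → 0 < R := fun k hk =>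
    (h.step_mem k hk).1.trans_le (h.step_mem k hk).2
  -- The factor `2 * R / β` combines `t² ≤ R t`, the bound `-‖v‖²/2` and the factor `β` of the
  -- step-size rule.
  have hstep : ∀ k : ℕ, (k : ℕ∞) < N → ∀ i,
      t k ^ 2 * ‖v k‖ ^ 2 ≤ 2 * R / β * (F (p k) i - F (p (k + 1)) i) := by
    intro k hk i
    obtain ⟨ht0, htR⟩ := h.step_mem k hk
    have h1 := h.decrease_apply hk i
    have h2 := jacobian_le_neg_norm_sq hσ (h.direction k hk) i
    have h3 : β * t k * (‖v k‖ ^ 2 / 2) ≤ F (p k) i - F (p (k + 1)) i := by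
      nlinarith [mul_pos hβ.1 ht0]
    have h4 : t k ^ 2 * ‖v k‖ ^ 2 ≤ R * (t k * ‖v k‖ ^ 2) := by
      have : 0 ≤ t k * ‖v k‖ ^ 2 := by positivity
      nlinarith
    have h5 : R * (t k * ‖v k‖ ^ 2) = 2 * R / β * (β * t k * (‖v k‖ ^ 2 / 2)) := by
      have := hβ.1.ne'
      field_simp
    rw [h5] at h4
    exact h4.trans (mul_le_mul_of_nonneg_left h3
      (div_nonneg (by linarith [hR k hk]) hβ.1.le))
  have hsum : ∀ K : ℕ, (K : ℕ∞) ≤ N → ∀ i,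
      ∑ k ∈ Finset.range K, t k ^ 2 * ‖v k‖ ^ 2 ≤ 2 * R / β * (F (p 0) i - F (p K) i) := by
    intro K
    induction K with
    | zero => intro _ i; simp
    | succ K ih =>
      intro hK i
      have hK' : (K : ℕ∞) < N := lt_of_lt_of_le (by exact_mod_cast Nat.lt_succ_self K) hK
      rw [Finset.sum_range_succ]
      have := ih hK'.le i
      have := hstep K hK' i
      linarith
  -- The maximum with `0` covers the empty sum, where no step certifies `R > 0`.
  refine summable_of_sum_le (c := max 0 (2 * R / β * C)) (fun k => by positivity) fun s => ?_
  rcases s.eq_empty_or_nonempty with rfl | ⟨k₀, hk₀⟩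
  · simp
  have hne : (s.image Subtype.val).Nonempty := ⟨k₀.1, Finset.mem_image_of_mem _ hk₀⟩
  set K := (s.image Subtype.val).max' hne with hKdef
  have hKN : (K : ℕ∞) < N := by
    obtain ⟨j, -, hj⟩ := Finset.mem_image.1 ((s.image Subtype.val).max'_mem hne)
    rw [hKdef, ← hj]
    exact j.2
  have h1 : ∑ k ∈ s, t k ^ 2 * ‖v k‖ ^ 2
      ≤ ∑ k ∈ Finset.range (K + 1), t k ^ 2 * ‖v k‖ ^ 2 := by
    rw [← Finset.sum_image (f := fun k => t k ^ 2 * ‖v k‖ ^ 2) (g := Subtype.val)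
      (fun a _ b _ hab => Subtype.ext hab)]
    refine Finset.sum_le_sum_of_subset_of_nonneg (fun k hk => ?_) fun k _ _ => by positivity
    exact Finset.mem_range.2 (Nat.lt_succ_of_le (Finset.le_max' _ _ hk))
  -- The minimizing index depends on `K`, which is why the telescoped bound was proved for every
  -- `i`.
  obtain ⟨i, hi⟩ := exists_eq_ciInf_of_finite (f := fun i => F (p 0) i - F (p (K + 1)) i)
  have h2 := hsum (K + 1) (by exact_mod_cast Order.add_one_le_of_lt hKN) i
  have h3 : F (p 0) i - F (p (K + 1)) i ≤ C := hi.le.trans (hC' _)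
  refine (h1.trans h2).trans (le_trans ?_ (le_max_right _ _))
  exact mul_le_mul_of_nonneg_left h3 (div_nonneg (by linarith [hR K hKN]) hβ.1.le)

variable [IsManifold (𝓡 m) ∞ M]
  [IsContMDiffRiemannianBundle (𝓡 m) ∞ (Model m) (fun x : M => TangentSpace (𝓡 m) x)]

/-- For short times, locally uniformly in the initial velocity, the velocity of a geodesic stays
close to the initial one. -/
lemma eventually_phase_velocity_mem {c : M} {z : Model m × Model m}
    (hz : z.1 ∈ (extChartAt (𝓡 m) c).target) {W : Set (Model m × Model m)} (hW : W ∈ 𝓝 z) :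
    ∃ ε > 0, ∀ᶠ y in 𝓝 z, ∀ γ : ℝ → M, IsGeodesic m γ → velocity m γ 0 = unphase c y →
      ∀ s ∈ Ioo (-ε) ε, γ s ∈ (extChartAt (𝓡 m) c).source ∧ phase c (velocity m γ s) ∈ W := by
  obtain ⟨ε, hε, hev⟩ := exists_isGeodesicAt_uniform (M := M) c hz hW
  refine ⟨ε, hε, hev.mono fun y hy γ hγ h0 s hs => ?_⟩
  obtain ⟨η, hη0, hη⟩ := hy 0
  simp only [zero_sub, zero_add] at hη
  have heq : EqOn γ η (Ioo (-ε) ε) := eqOn_of_isGeodesicAt (m := m) isOpen_Ioo isPreconnected_Ioo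
    (fun t _ => isGeodesic_iff.1 hγ t) (fun t ht => (hη t ht).1) (t₀ := 0)
    ⟨by linarith, hε⟩ (h0.trans hη0.symm)
  rw [heq hs, velocity_congr (heq.eventuallyEq_of_mem (isOpen_Ioo.mem_nhds hs))]
  exact (hη s hs).2

/-- Cluster points of an infinite run are Pareto critical. -/
lemma IsGenerated.isParetoCritical_of_mapClusterPt {F : M → Fin n → ℝ}
    (hF : ∀ i, ContMDiff (𝓡 m) 𝓘(ℝ, ℝ) 1 (fun p => F p i)) {σ β R : ℝ} (hσ : σ ∈ Ioo (0 : ℝ) 1)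
    (hβ : β ∈ Ioo (0 : ℝ) 1)
    {p : ℕ → M} {v : ∀ k, TangentSpace (𝓡 m) (p k)} {t : ℕ → ℝ} {γ : ℕ → ℝ → M}
    (h : IsGenerated F σ β R ⊤ p v t γ)
    (hstep : (∃ a : ℝ, 0 < a ∧ ∀ k, a ≤ t k) ∨ ∃ ν ∈ Ioo (0 : ℝ) 1, IsArmijo F β ν p v t γ)
    {q : M} (hq : MapClusterPt q atTop p) : IsParetoCritical m F q := by
  by_contra hcrit
  have htop : ∀ k : ℕ, (k : ℕ∞) < ⊤ := fun k => ENat.natCast_lt_top k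
  -- Along an ultrafilter every eventually bounded finite-dimensional quantity converges, so no
  -- further subsequences are needed.
  obtain ⟨U, hU, hUq⟩ := mapClusterPt_iff_ultrafilter.1 hq
  obtain ⟨a, ha, hnear⟩ := exists_alpha_le_near hF hcrit
  have hjac : ∀ᶠ k in (U : Filter ℕ), ∀ i,
      jacobian F (p k) (v k) i ≤ -((1 - σ) * a) - ‖v k‖ ^ 2 / 2 := by
    filter_upwards [hUq.eventually hnear] with k ⟨w, hw⟩ i
    have := jacobian_le_of_mem_approxSteepest hσ (h.direction k (htop k)) w i
    nlinarith [hσ.2]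
  have hσa : 0 < (1 - σ) * a := mul_pos (by linarith [hσ.2]) ha
  have hdiff : Tendsto (fun k => F (p k) 0 - F (p (k + 1)) 0) atTop (𝓝 0) := by
    have hanti : Antitone fun k => F (p k) 0 := antitone_nat_of_succ_le fun k => by
      have h1 := h.decrease_apply (htop k) 0
      have h2 := h.jacobian_neg hσ (htop k) 0
      nlinarith [mul_pos hβ.1 (h.step_mem k (htop k)).1]
    have hlimU : Tendsto (fun k => F (p k) 0) U (𝓝 (F q 0)) :=
      ((hF 0).continuous.tendsto q).comp hUq
    -- A monotone sequence converges or tends to `-∞`; the limit `F q 0` along `U` excludes the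
    -- latter.
    rcases tendsto_atTop_of_antitone hanti with hbot | ⟨l, hl⟩
    · exact absurd hlimU (not_tendsto_nhds_of_tendsto_atBot (hbot.mono_left hU) _)
    · simpa using hl.sub (hl.comp (tendsto_add_atTop_nat 1))
  have ht0 : Tendsto t U (𝓝 0) := by
    have hb : 0 < β * ((1 - σ) * a) := mul_pos hβ.1 hσa
    have hlim : Tendsto (fun k => (F (p k) 0 - F (p (k + 1)) 0) / (β * ((1 - σ) * a))) U (𝓝 0) := by
      simpa using (hdiff.mono_left hU).div_const (β * ((1 - σ) * a))
    refine squeeze_zero' (Eventually.of_forall fun k => (h.step_mem k (htop k)).1.le) ?_ hlim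
    filter_upwards [hjac] with k hk
    rw [le_div_iff₀ hb]
    have h1 := h.decrease_apply (htop k) 0
    have h3 : jacobian F (p k) (v k) 0 ≤ -((1 - σ) * a) := by
      have := hk 0
      have := sq_nonneg ‖v k‖
      linarith
    have h4 := mul_le_mul_of_nonneg_left h3 (mul_pos hβ.1 (h.step_mem k (htop k)).1).le
    linarith
  rcases hstep with ⟨b, hb, hbt⟩ | ⟨ν, hν, harm⟩
  · obtain ⟨k, hk⟩ := (ht0.eventually (gt_mem_nhds hb)).exists
    exact absurd (hbt k) hk.not_ge
  have hqt : extChartAt (𝓡 m) q q ∈ (extChartAt (𝓡 m) q).target := mem_extChartAt_target q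
  have hsrc : ∀ᶠ k in (U : Filter ℕ), p k ∈ (extChartAt (𝓡 m) q).source :=
    hUq.eventually (extChartAt_source_mem_nhds q)
  have hx : Tendsto (fun k => extChartAt (𝓡 m) q (p k)) U (𝓝 (extChartAt (𝓡 m) q q)) :=
    (continuousAt_extChartAt q).tendsto.comp hUq
  obtain ⟨C, hC, hCev⟩ := exists_norm_phase_le (m := m) q
  set D : ℝ := ‖chartDeriv (fun p => F p 0) q (extChartAt (𝓡 m) q q)‖ + 1 with hD
  have hD0 : 0 < D := by positivity
  have hDev : ∀ᶠ k in (U : Filter ℕ),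
      ‖chartDeriv (fun p => F p 0) q (extChartAt (𝓡 m) q (p k))‖ < D :=
    (((chartDeriv_continuousAt (hF 0) hqt).norm.tendsto.comp hx).eventually
      (gt_mem_nhds (lt_add_one _)))
  have hbdd : ∀ᶠ k in (U : Filter ℕ), (phase q ⟨p k, v k⟩).2 ∈
      Metric.closedBall (0 : Model m) (C * (2 * (D * C))) := by
    filter_upwards [hUq.eventually hCev, hDev, hjac, hsrc] with k h1 h2 h3 h4
    have h5 := h1 (v k)
    have h6 := h3 0
    have h7 : jacobian F (p k) (v k) 0 = _ :=
      jacobian_eq_chartDeriv hF (P := ⟨p k, v k⟩) h4 0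
    have h8 := (abs_le.1 ((chartDeriv (fun p => F p 0) q
      (extChartAt (𝓡 m) q (p k))).le_opNorm (phase q ⟨p k, v k⟩).2)).1
    have h9 : ‖chartDeriv (fun p => F p 0) q (extChartAt (𝓡 m) q (p k))‖
        * ‖(phase q ⟨p k, v k⟩).2‖ ≤ D * (C * ‖v k‖) :=
      mul_le_mul h2.le h5 (norm_nonneg _) hD0.le
    have h10 : -(D * (C * ‖v k‖)) ≤ jacobian F (p k) (v k) 0 := by
      rw [h7]
      exact (neg_le_neg h9).trans h8
    -- The descent bound forces `‖v‖²/2 ≤ -⟨∇f_0, v⟩ ≤ D C ‖v‖`, which bounds `v k`.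
    have h11 : ‖v k‖ ^ 2 ≤ 2 * (D * C) * ‖v k‖ := by linarith
    have h12 : ‖v k‖ ≤ 2 * (D * C) := by
      by_contra hlt
      push Not at hlt
      have : 0 < ‖v k‖ := lt_trans (by positivity) hlt
      nlinarith
    rw [mem_closedBall_zero_iff]
    exact h5.trans (mul_le_mul_of_nonneg_left h12 hC.le)
  obtain ⟨b, -, hb⟩ := (isCompact_closedBall (0 : Model m) (C * (2 * (D * C)))).ultrafilter_le_nhds'
    (U.map fun k => (phase q ⟨p k, v k⟩).2) hbdd
  have hz : Tendsto (fun k => phase q ⟨p k, v k⟩) U (𝓝 (extChartAt (𝓡 m) q q, b)) :=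
    hx.prodMk_nhds hb
  have hlim : ∀ i, ContinuousAt (fun z : Model m × Model m => chartDeriv (fun p => F p i) q z.1 z.2)
      (extChartAt (𝓡 m) q q, b) := fun i =>
    (ContinuousAt.comp (f := Prod.fst) (x := (extChartAt (𝓡 m) q q, b))
      (chartDeriv_continuousAt (hF i) hqt) continuousAt_fst).clm_apply continuousAt_snd
  set H : Fin n → ℝ := fun i => chartDeriv (fun p => F p i) q (extChartAt (𝓡 m) q q) b with hH
  have hHk : ∀ i, Tendsto (fun k => jacobian F (p k) (v k) i) U (𝓝 (H i)) := fun i => by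
    refine ((hlim i).tendsto.comp hz).congr' ?_
    filter_upwards [hsrc] with k hk
    exact (jacobian_eq_chartDeriv hF (P := ⟨p k, v k⟩) hk i).symm
  have hHneg : ∀ i, H i < 0 := fun i => by
    have : H i ≤ -((1 - σ) * a) := le_of_tendsto (hHk i) (hjac.mono fun k hk => by
      have := hk i
      have := sq_nonneg ‖v k‖
      linarith)
    linarith
  -- The number `r i` separates derivatives along nearby short geodesics, which stay close to `H i`,
  -- from the target slopes, which are close to `β * H i`.
  obtain ⟨r, hr⟩ : ∃ r : Fin n → ℝ, ∀ i, H i < r i ∧ r i < β * H i :=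
    ⟨fun i => (H i + β * H i) / 2, fun i => by
      constructor <;> nlinarith [hHneg i, hβ.2]⟩
  have hW : {z : Model m × Model m | ∀ i, chartDeriv (fun p => F p i) q z.1 z.2 < r i} ∈
      𝓝 (extChartAt (𝓡 m) q q, b) :=
    eventually_all.2 fun i => (hlim i).eventually (gt_mem_nhds (hr i).1)
  obtain ⟨ε, hε, hflow⟩ := eventually_phase_velocity_mem (M := M) hqt hW
  have htν : Tendsto (fun k => t k / ν) U (𝓝 0) := by simpa using ht0.div_const ν
  have hβH : ∀ᶠ k in (U : Filter ℕ), ∀ i, r i < β * jacobian F (p k) (v k) i :=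
    eventually_all.2 fun i => ((hHk i).const_mul β).eventually (lt_mem_nhds (hr i).2)
  obtain ⟨k, hk1, hk2, hk3, hk4, hk5⟩ := ((hz.eventually hflow).and (hsrc.and
    ((htν.eventually (gt_mem_nhds hε)).and ((ht0.eventually (gt_mem_nhds one_pos)).and
      hβH)))).exists
  rw [unphase_phase (P := ⟨p k, v k⟩) hk2] at hk1
  have hgeo := hk1 (γ k) (h.geodesic k (htop k)) (h.initial k (htop k))
  have htk := (h.step_mem k (htop k)).1
  have hsd : SufficientDecrease F β (p k) (v k) (γ k) (t k / ν) := by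
    refine sufficientDecrease_of_jacobian_le hF (h.geodesic k (htop k)) (h.initial k (htop k))
      (div_pos htk hν.1).le fun i s hs => ?_
    obtain ⟨h1, h2⟩ := hgeo s ⟨by linarith [hs.1], hs.2.trans hk3⟩
    rw [jacobian_eq_chartDeriv hF (P := velocity m (γ k) s) h1]
    exact ((h2 i).trans (hk5 i)).le
  obtain ⟨j, hj, -⟩ := (harm k).1
  -- Exponent `0` would mean `t k = 1`, excluded by `t k < 1`. Otherwise `t k / ν = ν ^ j` is an
  -- admissible candidate larger than `t k`.
  obtain _ | j := j
  · rw [pow_zero] at hj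
    linarith
  · have hle : t k / ν ≤ t k := (harm k).2 ⟨j, by
      rw [hj, pow_succ, mul_div_assoc, div_self hν.1.ne', mul_one], hsd⟩
    rw [div_le_iff₀ hν.1] at hle
    nlinarith [hν.2]

end Algorithm
end ParetoDescent

theorem proposition2p3 {m n : ℕ} [NeZero n] {M : Type*} [MetricSpace M]
    [ChartedSpace (ParetoDescent.Model m) M] [IsManifold (𝓡 m) ∞ M]
    [RiemannianBundle (fun x : M => TangentSpace (𝓡 m) x)]
    [IsContMDiffRiemannianBundle (𝓡 m) ∞ (ParetoDescent.Model m)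
      (fun x : M => TangentSpace (𝓡 m) x)]
    [IsRiemannianManifold (𝓡 m) M] [ConnectedSpace M] [CompleteSpace M]
    (F : M → Fin n → ℝ) (hF : ∀ i, ContMDiff (𝓡 m) 𝓘(ℝ, ℝ) 1 (fun p => F p i))
    (σ β R : ℝ) (hσ : σ ∈ Ioo (0 : ℝ) 1) (hβ : β ∈ Ioo (0 : ℝ) 1) (hR : 1 ≤ R) :
    -- every step of the algorithm can be carried out
    (∀ p : M, ¬ ParetoDescent.IsParetoCritical m F p →
      (ParetoDescent.approxSteepest m F σ p).Nonempty ∧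
      ∀ v ∈ ParetoDescent.approxSteepest m F σ p,
        (∃ γ : ℝ → M, ParetoDescent.IsGeodesic m γ ∧ ParetoDescent.velocity m γ 0 = ⟨p, v⟩) ∧
        ∀ γ : ℝ → M, ParetoDescent.IsGeodesic m γ → ParetoDescent.velocity m γ 0 = ⟨p, v⟩ →
          ∃ t ∈ Ioc (0 : ℝ) 1, ParetoDescent.SufficientDecrease F β p v γ t) ∧
    -- properties of every generated (finite or infinite) sequence
    (∀ (N : ℕ∞) (p : ℕ → M) (v : ∀ k, TangentSpace (𝓡 m) (p k)) (t : ℕ → ℝ) (γ : ℕ → ℝ → M),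
      ParetoDescent.IsGenerated F σ β R N p v t γ →
      (∀ k : ℕ, (k : ℕ∞) < N →
        F (p (k + 1)) ≤ F (p k) ∧ ∀ s ∈ Icc 0 (t k), dist (γ k s) (p k) ≤ s * ‖v k‖) ∧
      (ParetoDescent.MeritIsReal F →
        Summable fun k : {k : ℕ // (k : ℕ∞) < N} => t k ^ 2 * ‖v k‖ ^ 2) ∧
      (N = ⊤ →
        ((∃ a : ℝ, 0 < a ∧ ∀ k, a ≤ t k) ∨
          ∃ ν ∈ Ioo (0 : ℝ) 1, ParetoDescent.IsArmijo F β ν p v t γ) →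
        ∀ q : M, MapClusterPt q atTop p → ParetoDescent.IsParetoCritical m F q)) := by
  refine ⟨fun p hp => ⟨ParetoDescent.approxSteepest_nonempty F hσ p, fun v hv =>
    ⟨ParetoDescent.exists_isGeodesic ⟨p, v⟩, fun γ hγ h0 =>
      ParetoDescent.exists_sufficientDecrease hF hβ
        (ParetoDescent.jacobian_neg_of_mem_approxSteepest hσ hp hv) hγ h0⟩⟩, ?_⟩
  intro N p v t γ h
  refine ⟨fun k hk => ⟨fun i => ?_, fun s hs => ?_⟩, h.summable hσ hβ, ?_⟩
  · have h1 := h.decrease_apply hk i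
    have h2 := h.jacobian_neg hσ hk i
    have h3 := mul_pos hβ.1 (h.step_mem k hk).1
    nlinarith
  · have h1 := ParetoDescent.dist_le_of_isGeodesic (h.geodesic k hk) hs.1
    rw [h.initial k hk] at h1
    have h2 : γ k 0 = p k := congrArg TotalSpace.proj (h.initial k hk)
    rwa [h2] at h1
  · rintro rfl hstep q hq
    exact h.isParetoCritical_of_mapClusterPt hF hσ hβ hstep hq
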